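/- Let $X$ be a nonempty complete locally compact length space (a metric space in which the distance of two points is the infimum of the lengths of the curves joining them). For a collection $\mathcal U$ of open sets covering $X$ and $p\in X$ let $\pi_1(X,\mathcal U,p)\subset\pi_1(X,p)$ be the subgroup generated by the classes of the loops $\alpha\beta\alpha^{-1}$, where $\beta$ is a loop lying in an element of $\mathcal U$ and $\alpha$ is a path from $p$ to $\beta(0)$; the Spanier cover $\tilde X_{\mathcal U}$ is the covering space of $X$ with covering group $\pi_1(X,\mathcal U,p)$, with the length metric lifted from $X$. Two covers are called equal if they are homeomorphic over $X$. For $\delta>0$, $R>0$, $x\in X$: * the $\delta$-cover $\tilde X^\delta$ is the Spanier cover of the collection of all open balls of radius $\delta$, and $\mathrm{CovSpec}(X)=\{\delta>0:\tilde X^{\delta}\ne\tilde X^{\delta'}\ \forall\delta'>\delta\}$; * the $R$ cut-off $\delta$-cover $\tilde X^{\delta,R}_{cut}$ based at $x$ is the Spanier cover of the collection of all open balls of radius $\delta$ together with $X\setminus\bar B_x(R)$, and $\mathrm{CovSpec}^R_{cut}(X,x)=\{\delta>0:\tilde X^{\delta,R}_{cut}\ne\tilde X^{\delta',R}_{cut}\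 \forall\delta'>\delta\}$; * the cut-off $\delta$-cover $\tilde X^\delta_{cut}$ is the (complete) pointed Gromov–Hausdorff limit, as $R\to\infty$, of the covers $\tilde X^{\delta,R}_{cut}$ together with their projections to $X$, and $\mathrm{CovSpec}_{cut}(X)=\{\delta>0:\tilde X^{\delta}_{cut}\ne\tilde X^{\delta'}_{cut}\ \forall\delta'>\delta\}$. A set $A\subset\mathbb R$ is lower semiclosed if it contains the limit of every convergent decreasing sequence of its elements, and $Cl_{lower}(A)$ is the intersection of all lower semiclosed sets containing $A$. Then for every $\delta>0$ the cut-off $\delta$-cover exists for every base point $x$, and is unique up to isometry over $X$, independently of the base points, so that $\mathrm{CovSpec}_{cut}(X)$ is well defined; moreover $$\mathrm{CovSpec}_{cut}(X)\subset \mathrm{CovSpec}(X),$$ and for every $x\in X$ $$Cl_{lower}\Big(\bigcup_{R>0}\mathrm{CovSpec}^{R}_{cut}(X,x)\Big)\cup\{0\}=\mathrm{CovSpec}_{cut}(X)\cup\{0\}.$$ -/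

import Mathlib

open Set Filter Topology

universe u

namespace CutoffSpectrum

section Lengths

variable {X : Type u}

/-- The length of a curve: its total variation, with values in `[0, ∞]`. -/
noncomputable def curveLength [PseudoEMetricSpace X] {x y : X} (c : Path x y) : ENNReal :=
  eVariationOn c univ

/-- A metric space is a length space if the distance between two points is the infimum of the
lengths of the curves joining them. (Distances are finite, so any two points are joined by a curve
of finite length.) -/
def IsLengthSpace (X : Type u) [MetricSpace X] : Prop :=
  ∀ x y : X, edist x y = ⨅ c : Path x y, curveLength c

end Lengths

section Covers

variable {X : Type u}

/-- The homotopy class of a loop, as an element of the fundamental group. -/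
noncomputable def loopClass [TopologicalSpace X] {p : X} (c : Path p p) : FundamentalGroup X p :=
  FundamentalGroup.fromPath (Path.Homotopic.Quotient.mk c)

/-- The subgroup `π₁(X, 𝒰, p)` of `π₁(X, p)` generated by the classes of the loops
`α β α⁻¹`, where `α` is a path from `p` to some point `q` and `β` is a loop at `q` that lies in an
element of `𝒰`. -/
noncomputable def spanierGroup [TopologicalSpace X] (𝒰 : Set (Set X)) (p : X) :
    Subgroup (FundamentalGroup X p) :=
  Subgroup.closure {g | ∃ (q : X) (α : Path p q) (β : Path q q),
    (∃ U ∈ 𝒰, range β ⊆ U) ∧ g = loopClass ((α.trans β).trans α.symm)}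

/-- Two paths `γ`, `σ` starting at `p` are equivalent modulo `H` if they have the same end point
and the class of the loop `γ σ⁻¹` belongs to `H`. -/
def PathRel [TopologicalSpace X] {p : X} (H : Subgroup (FundamentalGroup X p))
    (a b : Σ y : X, Path p y) : Prop :=
  ∃ h : a.1 = b.1, loopClass (a.2.trans (b.2.cast rfl h).symm) ∈ H

theorem pathRel_mk_iff [TopologicalSpace X] {p : X} (H : Subgroup (FundamentalGroup X p))
    {y : X} (γ σ : Path p y) :
    PathRel H ⟨y, γ⟩ ⟨y, σ⟩ ↔ loopClass (γ.trans σ.symm) ∈ H :=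
  ⟨fun ⟨_, h⟩ => h, fun h => ⟨rfl, h⟩⟩

theorem loopClass_trans_symm_self [TopologicalSpace X] {p y : X} (γ : Path p y) :
    loopClass (γ.trans γ.symm) = 1 := by
  rw [FundamentalGroup.one_def]
  simp [loopClass]

theorem loopClass_inv [TopologicalSpace X] {p y : X} (γ σ : Path p y) :
    loopClass (σ.trans γ.symm) = (loopClass (γ.trans σ.symm))⁻¹ := by
  have : loopClass (γ.trans σ.symm) * loopClass (σ.trans γ.symm) = 1 := by
    rw [FundamentalGroup.mul_def, FundamentalGroup.one_def]
    simp only [loopClass, Path.Homotopic.Quotient.mk_trans, Path.Homotopic.Quotient.mk_symm]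
    rw [Path.Homotopic.Quotient.trans_assoc,
      ← Path.Homotopic.Quotient.trans_assoc (Path.Homotopic.Quotient.symm _)]
    simp
  exact eq_inv_of_mul_eq_one_right this

theorem loopClass_mul [TopologicalSpace X] {p y : X} (γ σ τ : Path p y) :
    loopClass (γ.trans τ.symm) =
      loopClass (σ.trans τ.symm) * loopClass (γ.trans σ.symm) := by
  rw [FundamentalGroup.mul_def]
  simp only [loopClass, Path.Homotopic.Quotient.mk_trans, Path.Homotopic.Quotient.mk_symm]
  rw [Path.Homotopic.Quotient.trans_assoc,
    ← Path.Homotopic.Quotient.trans_assoc (Path.Homotopic.Quotient.symm _)]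
  simp

theorem loopClass_trans [TopologicalSpace X] {p y z : X} (γ σ : Path p y) (c : Path y z) :
    loopClass ((γ.trans c).trans (σ.trans c).symm) = loopClass (γ.trans σ.symm) := by
  simp only [loopClass, Path.trans_symm, Path.Homotopic.Quotient.mk_trans,
    Path.Homotopic.Quotient.mk_symm]
  rw [Path.Homotopic.Quotient.trans_assoc,
    ← Path.Homotopic.Quotient.trans_assoc (Path.Homotopic.Quotient.mk c)]
  simp

theorem pathRel_equivalence [TopologicalSpace X] {p : X} (H : Subgroup (FundamentalGroup X p)) :
    Equivalence (PathRel H) where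
  refl := by
    rintro ⟨y, γ⟩
    rw [pathRel_mk_iff, loopClass_trans_symm_self]
    exact H.one_mem
  symm := by
    rintro ⟨y, γ⟩ ⟨z, σ⟩ ⟨h, hm⟩
    obtain rfl : y = z := h
    rw [pathRel_mk_iff, loopClass_inv]
    exact H.inv_mem hm
  trans := by
    rintro ⟨y, γ⟩ ⟨z, σ⟩ ⟨w, τ⟩ ⟨h, hm⟩ ⟨h', hm'⟩
    obtain rfl : y = z := h
    obtain rfl : y = w := h'
    rw [pathRel_mk_iff, loopClass_mul γ σ τ]
    exact H.mul_mem hm' hm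

/-- The space of paths in `X` starting at `p`, modulo the subgroup `H` of `π₁(X, p)`: the standard
model of the covering space of `X` with covering group `H`. For `H = spanierGroup 𝒰 p` this is the Spanier cover
of `X` associated with the collection `𝒰` of open sets. -/
def PathCover [TopologicalSpace X] {p : X} (H : Subgroup (FundamentalGroup X p)) : Type u :=
  Quotient (⟨PathRel H, pathRel_equivalence H⟩ : Setoid (Σ y : X, Path p y))

namespace PathCover

/-- The point of the cover represented by a path starting at `p`. -/
def mk [TopologicalSpace X] {p : X} (H : Subgroup (FundamentalGroup X p)) {y : X}
    (γ : Path p y) : PathCover H :=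
  Quotient.mk _ ⟨y, γ⟩

/-- The covering projection: the end point of a path. -/
def proj [TopologicalSpace X] {p : X} (H : Subgroup (FundamentalGroup X p)) :
    PathCover H → X :=
  Quotient.lift (fun a => a.1) (fun _ _ h => h.1)

/-- The base point of the cover, a lift of `p`: the class of the constant path. -/
def base [TopologicalSpace X] {p : X} (H : Subgroup (FundamentalGroup X p)) : PathCover H :=
  mk H (Path.refl p)

theorem mk_eq_mk_iff [TopologicalSpace X] {p : X} (H : Subgroup (FundamentalGroup X p)) {y : X}
    (γ σ : Path p y) : mk H γ = mk H σ ↔ loopClass (γ.trans σ.symm) ∈ H :=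
  Quotient.eq.trans (pathRel_mk_iff H γ σ)

/-- The length metric on the cover. A curve in the cover starting at `[γ]` is the lift of a curve
`c` of `X` starting at the end point of `γ`; the lift ends at `[γ c]`, and its length is the length
of `c`. The distance of two points is the infimum of the lengths of the curves joining them. -/
noncomputable def coverEDist [PseudoEMetricSpace X] {p : X} (H : Subgroup (FundamentalGroup X p))
    (a b : PathCover H) : ENNReal :=
  ⨅ (y : X) (z : X) (γ : Path p y) (c : Path y z) (_ : mk H γ = a) (_ : mk H (γ.trans c) = b),
    curveLength c

theorem coverEDist_le [PseudoEMetricSpace X] {p : X} (H : Subgroup (FundamentalGroup X p))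
    {y z : X} (γ : Path p y) (c : Path y z) :
    coverEDist H (mk H γ) (mk H (γ.trans c)) ≤ curveLength c :=
  iInf_le_of_le y <| iInf_le_of_le z <| iInf_le_of_le γ <| iInf_le_of_le c <|
    iInf_le_of_le rfl <| iInf_le_of_le rfl le_rfl

theorem le_coverEDist [PseudoEMetricSpace X] {p : X} (H : Subgroup (FundamentalGroup X p))
    {a b : PathCover H} {m : ENNReal}
    (h : ∀ (y z : X) (γ : Path p y) (c : Path y z), mk H γ = a → mk H (γ.trans c) = b →
      m ≤ curveLength c) : m ≤ coverEDist H a b :=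
  le_iInf fun y => le_iInf fun z => le_iInf fun γ => le_iInf fun c => le_iInf fun ha =>
    le_iInf fun hb => h y z γ c ha hb

end PathCover

theorem curveLength_refl [PseudoEMetricSpace X] (x : X) : curveLength (Path.refl x) = 0 := by
  apply eVariationOn.constant_on
  rintro _ ⟨s, _, rfl⟩ _ ⟨t, _, rfl⟩
  rfl

theorem curveLength_symm_le [PseudoEMetricSpace X] {x y : X} (c : Path x y) :
    curveLength c.symm ≤ curveLength c := by
  have h : (c.symm : unitInterval → X) = c ∘ unitInterval.symm := rfl
  rw [curveLength, h]
  refine eVariationOn.comp_le_of_antitoneOn _ _ ?_ (fun _ _ => mem_univ _)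
  intro s _ t _ hst
  exact unitInterval.strictAnti_symm.antitone hst

theorem curveLength_eq_extend [PseudoEMetricSpace X] {x y : X} (c : Path x y) :
    curveLength c = eVariationOn c.extend (Icc 0 1) := by
  apply le_antisymm
  · have h : (c : unitInterval → X) = c.extend ∘ Subtype.val := by
      ext t; simp
    rw [curveLength, h]
    exact eVariationOn.comp_le_of_monotoneOn _ _ (fun s _ t _ hst => hst) (fun t _ => t.2)
  · exact eVariationOn.comp_le_of_monotoneOn _ _
      (fun s _ t _ hst => monotone_projIcc zero_le_one hst) (fun _ _ => mem_univ _)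

theorem curveLength_trans_le [PseudoEMetricSpace X] {x y z : X} (c : Path x y) (d : Path y z) :
    curveLength (c.trans d) ≤ curveLength c + curveLength d := by
  rw [curveLength_eq_extend (c.trans d)]
  have hs := eVariationOn.union (c.trans d).extend (s := Icc (0 : ℝ) (1 / 2))
    (t := Icc (1 / 2 : ℝ) 1) (x := 1 / 2) (isGreatest_Icc (by norm_num))
    (isLeast_Icc (by norm_num))
  rw [Icc_union_Icc_eq_Icc (by norm_num) (by norm_num)] at hs
  rw [hs]
  refine add_le_add ?_ ?_
  · have h : EqOn (c.trans d).extend ((c : unitInterval → X) ∘ fun t : ℝ =>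
        projIcc (0 : ℝ) 1 zero_le_one (2 * t)) (Icc (0 : ℝ) (1 / 2)) := by
      intro t ht
      have ht' : t ∈ Icc (0 : ℝ) 1 := ⟨ht.1, ht.2.trans (by norm_num)⟩
      rw [Path.extend_apply _ ht', Path.trans_apply, dif_pos ht.2]
      simp only [Function.comp]
      congr 1
      rw [projIcc_of_mem]
    rw [eVariationOn.congr h]
    exact eVariationOn.comp_le_of_monotoneOn _ _
      (fun s _ t _ hst => monotone_projIcc zero_le_one (by linarith)) (fun _ _ => mem_univ _)
  · have h : EqOn (c.trans d).extend ((d : unitInterval → X) ∘ fun t : ℝ =>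
        projIcc (0 : ℝ) 1 zero_le_one (2 * t - 1)) (Icc (1 / 2 : ℝ) 1) := by
      intro t ht
      have ht' : t ∈ Icc (0 : ℝ) 1 := ⟨le_trans (by norm_num) ht.1, ht.2⟩
      rw [Path.extend_apply _ ht', Path.trans_apply]
      simp only [Function.comp]
      split_ifs with hh
      · have : t = 1 / 2 := le_antisymm hh ht.1
        subst this
        norm_num
      · congr 1
        rw [projIcc_of_mem]
    rw [eVariationOn.congr h]
    exact eVariationOn.comp_le_of_monotoneOn _ _
      (fun s _ t _ hst => monotone_projIcc zero_le_one (by linarith)) (fun _ _ => mem_univ _)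

theorem PathCover.mk_trans_congr [TopologicalSpace X] {p : X}
    (H : Subgroup (FundamentalGroup X p)) {y z : X} {γ σ : Path p y} (h : mk H γ = mk H σ)
    (c : Path y z) : mk H (γ.trans c) = mk H (σ.trans c) := by
  rw [mk_eq_mk_iff] at h ⊢
  rwa [loopClass_trans]

theorem PathCover.mk_eq_of_homotopic [TopologicalSpace X] {p : X}
    (H : Subgroup (FundamentalGroup X p)) {y : X} {γ σ : Path p y}
    (h : Path.Homotopic.Quotient.mk γ = Path.Homotopic.Quotient.mk σ) : mk H γ = mk H σ := by
  rw [mk_eq_mk_iff]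
  have : loopClass (γ.trans σ.symm) = loopClass (σ.trans σ.symm) := by
    simp only [loopClass, Path.Homotopic.Quotient.mk_trans, h]
  rw [this, loopClass_trans_symm_self]
  exact H.one_mem

/-- The cover carries the length metric described above. (In general this is only an extended
pseudometric; for the covers of a length space considered below it is a metric.) -/
noncomputable instance PathCover.instPseudoEMetricSpace [PseudoEMetricSpace X] {p : X}
    (H : Subgroup (FundamentalGroup X p)) : PseudoEMetricSpace (PathCover H) where
  edist := PathCover.coverEDist H
  edist_self := by
    rintro ⟨y, γ⟩
    have h := PathCover.coverEDist_le H γ (Path.refl y)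
    rw [curveLength_refl, PathCover.mk_eq_of_homotopic H (γ := γ.trans (Path.refl y)) (σ := γ)
      (by simp)] at h
    exact le_antisymm h zero_le
  edist_comm := by
    have key : ∀ a b : PathCover H, PathCover.coverEDist H a b ≤ PathCover.coverEDist H b a := by
      intro a b
      refine PathCover.le_coverEDist H ?_
      rintro y z γ c rfl rfl
      have h := PathCover.coverEDist_le H (γ.trans c) c.symm
      rw [PathCover.mk_eq_of_homotopic H (γ := (γ.trans c).trans c.symm) (σ := γ)
        (by simp [Path.Homotopic.Quotient.trans_assoc])] at h
      exact h.trans (curveLength_symm_le c)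
    exact fun a b => le_antisymm (key a b) (key b a)
  edist_triangle := by
    intro a b e
    have h1 : ∀ (y z : X) (γ : Path p y) (c : Path y z), PathCover.mk H γ = a →
        PathCover.mk H (γ.trans c) = b →
        PathCover.coverEDist H a e ≤ curveLength c + PathCover.coverEDist H b e := by
      rintro y z γ c rfl rfl
      unfold PathCover.coverEDist
      simp only [ENNReal.add_iInf]
      refine le_iInf fun y' => le_iInf fun z' => le_iInf fun γ' => le_iInf fun c' =>
        le_iInf fun hb => le_iInf fun he => ?_
      have hy : y' = z := congrArg (PathCover.proj H) hb
      subst hy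
      subst he
      have h := PathCover.coverEDist_le H γ (c.trans c')
      rw [PathCover.mk_eq_of_homotopic H (γ := γ.trans (c.trans c')) (σ := (γ.trans c).trans c')
        (by simp [Path.Homotopic.Quotient.trans_assoc]),
        ← PathCover.mk_trans_congr H hb c'] at h
      exact h.trans (curveLength_trans_le c c')
    have h2 : PathCover.coverEDist H a e ≤
        PathCover.coverEDist H a b + PathCover.coverEDist H b e := by
      conv_rhs => unfold PathCover.coverEDist
      simp only [ENNReal.iInf_add]
      exact le_iInf fun y => le_iInf fun z => le_iInf fun γ => le_iInf fun c =>
        le_iInf fun ha => le_iInf fun hb => h1 y z γ c ha hb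
    exact h2

/-- Equality of two covering spaces of `X`: there is a homeomorphism commuting with the covering
projections. -/
def SameCover [TopologicalSpace X] {E F : Type u} [TopologicalSpace E] [TopologicalSpace F]
    (π : E → X) (ρ : F → X) : Prop :=
  ∃ Φ : E ≃ₜ F, ∀ a, ρ (Φ a) = π a

end Covers

section Spectra

variable {X : Type u} [MetricSpace X]

/-- The collection of all open balls of radius `δ`. -/
def deltaBalls (X : Type u) [MetricSpace X] (δ : ℝ) : Set (Set X) :=
  {U | ∃ q : X, U = Metric.ball q δ}

/-- The collection of all open balls of radius `δ` together with the complement of the closed ball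
of radius `R` around `x`. -/
def cutoffSets (δ R : ℝ) (x : X) : Set (Set X) :=
  deltaBalls X δ ∪ {(Metric.closedBall x R)ᶜ}

/-- The covering group of the `δ`-cover of `X`, which is the Spanier cover
`PathCover (deltaGroup δ p)` associated with the collection of all open balls of radius `δ`. -/
noncomputable def deltaGroup (δ : ℝ) (p : X) : Subgroup (FundamentalGroup X p) :=
  spanierGroup (deltaBalls X δ) p

/-- The covering group of the `R` cut-off `δ`-cover of `X` based at `x`, which is the Spanier cover
`PathCover (cutoffGroup δ R x)` associated with the collection `cutoffSets δ R x`. -/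
noncomputable def cutoffGroup (δ R : ℝ) (x : X) : Subgroup (FundamentalGroup X x) :=
  spanierGroup (cutoffSets δ R x) x

/-- The covering spectrum: all `δ > 0` such that the `δ`-cover differs from the `δ'`-cover for all
`δ' > δ`. (For path connected `X` the choice of the base point `p` is irrelevant.) -/
def covSpec (X : Type u) [MetricSpace X] : Set ℝ :=
  {δ | 0 < δ ∧ ∀ δ' > δ, ∀ p : X,
    ¬ SameCover (PathCover.proj (deltaGroup δ p)) (PathCover.proj (deltaGroup δ' p))}

/-- The `R` cut-off covering spectrum of the pointed space `(X, x)`. -/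
def rCutoffCovSpec (R : ℝ) (x : X) : Set ℝ :=
  {δ | 0 < δ ∧ ∀ δ' > δ,
    ¬ SameCover (PathCover.proj (cutoffGroup δ R x)) (PathCover.proj (cutoffGroup δ' R x))}

/-- Pointed Gromov-Hausdorff convergence, as `R → ∞`, of pointed spaces `(E R, e R)` with maps
`π R : E R → X` to the pointed space `(Y, y)` with the map `h : Y → X`: for all `r, ε > 0` and all
sufficiently large `R` there is an `ε`-Hausdorff approximation between the closed balls of radius
`r` around the base points, which commutes with the maps to `X` up to `ε`. -/
def GHTendsto {E : ℝ → Type u} [∀ R, PseudoEMetricSpace (E R)] (e : ∀ R, E R)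
    (π : ∀ R, E R → X) {Y : Type u} [MetricSpace Y] (y : Y) (h : Y → X) : Prop :=
  ∀ r > 0, ∀ ε > 0, ∀ᶠ R in atTop, ∃ f : E R → Y,
    f (e R) = y ∧
    (∀ a, edist a (e R) ≤ ENNReal.ofReal r → edist (f a) y ≤ ENNReal.ofReal r) ∧
    (∀ a b, edist a (e R) ≤ ENNReal.ofReal r → edist b (e R) ≤ ENNReal.ofReal r →
      edist (f a) (f b) ≤ edist a b + ENNReal.ofReal ε ∧
      edist a b ≤ edist (f a) (f b) + ENNReal.ofReal ε) ∧
    (∀ z, edist z y ≤ ENNReal.ofReal r →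
      ∃ a, edist a (e R) ≤ ENNReal.ofReal r ∧ edist z (f a) ≤ ENNReal.ofReal ε) ∧
    (∀ a, edist a (e R) ≤ ENNReal.ofReal r → edist (h (f a)) (π R a) ≤ ENNReal.ofReal ε)

/-- The complete pointed metric space `(Y, y)`, with the projection `h : Y → X`, is the pointed
Gromov-Hausdorff limit, as `R → ∞`, of the `R` cut-off `δ`-covers of `X` based at `x`, with their
covering projections. -/
def IsCutoffLimit (δ : ℝ) (x : X) {Y : Type u} [MetricSpace Y] (y : Y) (h : Y → X) : Prop :=
  CompleteSpace Y ∧ Continuous h ∧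
    GHTendsto (fun R => PathCover.base (cutoffGroup δ R x))
      (fun R => PathCover.proj (cutoffGroup δ R x)) y h

/-- `Y`, with the projection `h : Y → X`, is the cut-off `δ`-cover of `X`: it is the limit of the
`R` cut-off `δ`-covers as `R → ∞`, for some base points. -/
def IsCutoffCover (δ : ℝ) {Y : Type u} [MetricSpace Y] (h : Y → X) : Prop :=
  ∃ (x : X) (y : Y), IsCutoffLimit δ x y h

/-- The cut-off covering spectrum: all `δ > 0` such that the cut-off `δ`-cover differs from the
cut-off `δ'`-cover for all `δ' > δ`. -/
def cutoffCovSpec (X : Type u) [MetricSpace X] : Set ℝ :=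
  {δ | 0 < δ ∧ ∀ δ' > δ, ∀ (Y Z : Type u) [MetricSpace Y] [MetricSpace Z] (h : Y → X) (k : Z → X),
    IsCutoffCover δ h → IsCutoffCover δ' k → ¬ SameCover h k}

end Spectra

/-- A set of real numbers is lower semiclosed if it contains the limit of every convergent
decreasing sequence of its elements. -/
def IsLowerSemiclosed (A : Set ℝ) : Prop :=
  ∀ (a : ℕ → ℝ) (l : ℝ), Antitone a → (∀ n, a n ∈ A) → Tendsto a atTop (𝓝 l) → l ∈ A

/-- The lower semiclosure: the intersection of all lower semiclosed sets containing `A`. -/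
def lowerSemiclosure (A : Set ℝ) : Set ℝ :=
  ⋂₀ {B | IsLowerSemiclosed B ∧ A ⊆ B}

end CutoffSpectrum

/-! Everything reduces to subgroups of `π₁(X, x)`. Let `G(δ, R)` be the covering group of the `R`
cut-off `δ`-cover. It shrinks as `R` grows, and the cut-off `δ`-cover is the cover with group `⋂ R,
G(δ, R)` (`limitGroup`).

Existence rests on stabilization. By Hopf-Rinow, `X` and all the covers involved are proper, and
fibres are uniformly discrete, so a bounded ball of the limit cover contains only finitely many
points over the base point. Hence for large `R` a loop of bounded length in `G(δ, R)` already lies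
in the intersection (`eventually_mem_limitGroup`), and the map from the limit cover to the `R`
cut-off cover is an isometry between balls of a given radius. Uniqueness is that of pointed
Gromov-Hausdorff limits over `X` of proper spaces (`exists_isometryEquiv_of_isApproximation`). A
change of base point conjugates the groups.

All these groups are normal, so two covers are equal over `X` exactly when their groups are
(`sameCover_iff_eq`). The spectra are then the jumps of increasing families of groups. Since `G(δ,
R)` is generated by the `δ`-group and a group not depending on `δ`, and contains the limit group,
which contains the `δ`-group, a jump of `G(·, R)` is a jump of the limit groups, and this is a jump
of the `δ`-groups. Conversely, if the limit groups jump at `δ`, then for each `δ' > δ` some `G(·,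
R)` changes between `δ` and `δ'`. As loops are compact, `G(·, R)` is continuous from the left, so it
has a jump in `[δ, δ')`; thus `δ` is a decreasing limit of `R` cut-off jumps, or one itself. -/

namespace CutoffSpectrum

/-! ### Homotopy classes of paths and Spanier groups. -/

section PathAlgebra

variable {X : Type u} [TopologicalSpace X]

theorem quotient_trans_symm_cancel {x y z : X} (a : Path.Homotopic.Quotient x y)
    (b : Path.Homotopic.Quotient y z) : a.symm.trans (a.trans b) = b := by
  rw [← Path.Homotopic.Quotient.trans_assoc]
  simp

theorem quotient_symm_mul {x y z : X} (a : Path.Homotopic.Quotient x y)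
    (b : Path.Homotopic.Quotient y z) : (a.trans b).symm = b.symm.trans a.symm := by
  induction a using Path.Homotopic.Quotient.ind with | mk a
  induction b using Path.Homotopic.Quotient.ind with | mk b
  simp [← Path.Homotopic.Quotient.mk_symm, ← Path.Homotopic.Quotient.mk_trans, Path.trans_symm]

theorem quotient_symm_symm {x y : X} (a : Path.Homotopic.Quotient x y) : a.symm.symm = a := by
  induction a using Path.Homotopic.Quotient.ind with | mk a
  simp [← Path.Homotopic.Quotient.mk_symm]

theorem loopClass_congr {p : X} {c d : Path p p}
    (h : Path.Homotopic.Quotient.mk c = Path.Homotopic.Quotient.mk d) :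
    loopClass c = loopClass d := by
  rw [loopClass, loopClass, h]

/-- Conjugation by `α` is a homomorphism, and it only lengthens the tail of each generator. The case
`p = p'` is normality of the Spanier group; the general case changes the base point. -/
theorem loopClass_conj_mem_spanierGroup {𝒰 : Set (Set X)} {p p' : X} (α : Path p' p)
    {c : Path p p} (h : loopClass c ∈ spanierGroup 𝒰 p) :
    loopClass ((α.trans c).trans α.symm) ∈ spanierGroup 𝒰 p' := by
  let φ : FundamentalGroup X p → FundamentalGroup X p' := fun g =>
    FundamentalGroup.fromPath (((Path.Homotopic.Quotient.mk α).trans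
      (FundamentalGroup.toPath g)).trans (Path.Homotopic.Quotient.mk α).symm)
  have key : ∀ g ∈ spanierGroup 𝒰 p, φ g ∈ spanierGroup 𝒰 p' := by
    intro g hg
    refine Subgroup.closure_induction (G := FundamentalGroup X p)
      (p := fun g _ => φ g ∈ spanierGroup 𝒰 p')
      ?_ ?_ ?_ ?_ hg
    · rintro _ ⟨q, σ, β, hβ, rfl⟩
      refine Subgroup.subset_closure ⟨q, α.trans σ, β, hβ, ?_⟩
      simp only [φ, loopClass, Path.Homotopic.Quotient.mk_trans,
        Path.Homotopic.Quotient.mk_symm, quotient_symm_mul, Path.Homotopic.Quotient.trans_assoc]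
    · have : φ (1 : FundamentalGroup X p) = 1 := by
        rw [FundamentalGroup.one_def, FundamentalGroup.one_def]
        simp [φ]
      rw [this]
      exact one_mem _
    · intro a b _ _ ha hb
      have : φ (a * b) = φ a * φ b := by
        rw [FundamentalGroup.mul_def, FundamentalGroup.mul_def]
        simp only [φ, Path.Homotopic.Quotient.trans_assoc, quotient_trans_symm_cancel]
      rw [this]
      exact mul_mem ha hb
    · intro a _ ha
      have : φ a⁻¹ = (φ a)⁻¹ := by
        rw [FundamentalGroup.inv_def, FundamentalGroup.inv_def]
        simp only [φ, quotient_symm_mul, quotient_symm_symm,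
          Path.Homotopic.Quotient.trans_assoc]
      rw [this]
      exact inv_mem ha
  have := key _ h
  simpa only [φ, loopClass, Path.Homotopic.Quotient.mk_trans,
    Path.Homotopic.Quotient.mk_symm] using this

theorem spanierGroup_mono {𝒰 𝒱 : Set (Set X)} (h : ∀ U ∈ 𝒰, ∃ V ∈ 𝒱, U ⊆ V) (p : X) :
    spanierGroup 𝒰 p ≤ spanierGroup 𝒱 p := by
  refine Subgroup.closure_mono ?_
  rintro _ ⟨q, σ, β, ⟨U, hU, hβ⟩, rfl⟩
  obtain ⟨V, hV, hUV⟩ := h U hU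
  exact ⟨q, σ, β, ⟨V, hV, hβ.trans hUV⟩, rfl⟩

theorem spanierGroup_union (𝒰 𝒱 : Set (Set X)) (p : X) :
    spanierGroup (𝒰 ∪ 𝒱) p = spanierGroup 𝒰 p ⊔ spanierGroup 𝒱 p := by
  rw [spanierGroup, spanierGroup, spanierGroup, ← Subgroup.closure_union]
  congr 1
  ext g
  constructor
  · rintro ⟨q, σ, β, ⟨U, hU | hU, hβ⟩, rfl⟩
    · exact Or.inl ⟨q, σ, β, ⟨U, hU, hβ⟩, rfl⟩
    · exact Or.inr ⟨q, σ, β, ⟨U, hU, hβ⟩, rfl⟩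
  · rintro (⟨q, σ, β, ⟨U, hU, hβ⟩, rfl⟩ | ⟨q, σ, β, ⟨U, hU, hβ⟩, rfl⟩)
    · exact ⟨q, σ, β, ⟨U, Or.inl hU, hβ⟩, rfl⟩
    · exact ⟨q, σ, β, ⟨U, Or.inr hU, hβ⟩, rfl⟩

end PathAlgebra

/-! ### Cut-off groups and their intersection over `R`. -/

section Groups

variable {X : Type u} [MetricSpace X]

/-- The intersection of the covering groups, with base point `p`, of the `R` cut-off `δ`-covers
centred at `x`. -/
noncomputable def limitGroup (δ : ℝ) (x p : X) : Subgroup (FundamentalGroup X p) :=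
  ⨅ R : ℝ, spanierGroup (cutoffSets δ R x) p

theorem deltaGroup_mono {δ δ' : ℝ} (h : δ ≤ δ') (p : X) : deltaGroup δ p ≤ deltaGroup δ' p := by
  refine spanierGroup_mono ?_ p
  rintro _ ⟨q, rfl⟩
  exact ⟨_, ⟨q, rfl⟩, Metric.ball_subset_ball h⟩

theorem spanierGroup_cutoffSets (δ R : ℝ) (x p : X) :
    spanierGroup (cutoffSets δ R x) p =
      deltaGroup δ p ⊔ spanierGroup {(Metric.closedBall x R)ᶜ} p :=
  spanierGroup_union _ _ p

theorem deltaGroup_le_spanierGroup_cutoffSets (δ R : ℝ) (x p : X) :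
    deltaGroup δ p ≤ spanierGroup (cutoffSets δ R x) p := by
  rw [spanierGroup_cutoffSets]
  exact le_sup_left

theorem deltaGroup_le_limitGroup (δ : ℝ) (x p : X) : deltaGroup δ p ≤ limitGroup δ x p :=
  le_iInf fun R => deltaGroup_le_spanierGroup_cutoffSets δ R x p

theorem limitGroup_le (δ R : ℝ) (x p : X) :
    limitGroup δ x p ≤ spanierGroup (cutoffSets δ R x) p :=
  iInf_le _ R

theorem spanierGroup_cutoffSets_mono {δ δ' : ℝ} (h : δ ≤ δ') (R : ℝ) (x p : X) :
    spanierGroup (cutoffSets δ R x) p ≤ spanierGroup (cutoffSets δ' R x) p := by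
  rw [spanierGroup_cutoffSets, spanierGroup_cutoffSets]
  exact sup_le_sup_right (deltaGroup_mono h p) _

theorem spanierGroup_cutoffSets_le_of_closedBall_subset {δ R R' : ℝ} {x x' : X}
    (h : Metric.closedBall x R ⊆ Metric.closedBall x' R') (p : X) :
    spanierGroup (cutoffSets δ R' x') p ≤ spanierGroup (cutoffSets δ R x) p := by
  refine spanierGroup_mono ?_ p
  rintro U (hU | rfl)
  · exact ⟨U, Or.inl hU, Subset.rfl⟩
  · exact ⟨_, Or.inr rfl, compl_subset_compl.2 h⟩

theorem limitGroup_mono {δ δ' : ℝ} (h : δ ≤ δ') (x p : X) :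
    limitGroup δ x p ≤ limitGroup δ' x p :=
  iInf_mono fun R => spanierGroup_cutoffSets_mono h R x p

/-- Balls around one centre lie in balls around the other, so the two decreasing families of groups
are cofinal in each other. -/
theorem limitGroup_center (δ : ℝ) (x x' p : X) : limitGroup δ x p = limitGroup δ x' p := by
  have key : ∀ x x' : X, limitGroup δ x p ≤ limitGroup δ x' p := by
    intro x x'
    refine le_iInf fun R => (limitGroup_le δ (R + dist x' x) x p).trans ?_
    refine spanierGroup_cutoffSets_le_of_closedBall_subset ?_ p
    exact Metric.closedBall_subset_closedBall' le_rfl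
  exact le_antisymm (key x x') (key x' x)

theorem loopClass_conj_mem_limitGroup {δ : ℝ} {x p p' : X} (α : Path p' p) {c : Path p p}
    (h : loopClass c ∈ limitGroup δ x p) :
    loopClass ((α.trans c).trans α.symm) ∈ limitGroup δ x p' := by
  rw [limitGroup, Subgroup.mem_iInf] at h ⊢
  exact fun R => loopClass_conj_mem_spanierGroup α (h R)

/-- The cut-off groups for `δ ≤ δ'` agree as soon as the smaller one contains the `δ'`-group. -/
theorem spanierGroup_cutoffSets_eq_of_le {δ δ' R : ℝ} {x p : X} (h : δ ≤ δ')
    (hle : deltaGroup δ' p ≤ spanierGroup (cutoffSets δ R x) p) :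
    spanierGroup (cutoffSets δ R x) p = spanierGroup (cutoffSets δ' R x) p := by
  refine le_antisymm (spanierGroup_cutoffSets_mono h R x p) ?_
  rw [spanierGroup_cutoffSets δ']
  refine sup_le hle ?_
  rw [spanierGroup_cutoffSets]
  exact le_sup_right

/-- A loop in an open ball lies in a smaller concentric ball. -/
theorem exists_lt_range_subset_ball {q q' : X} {δ : ℝ} {β : Path q' q'}
    (h : range β ⊆ Metric.ball q δ) : ∃ s < δ, ∀ t > s, range β ⊆ Metric.ball q t := by
  obtain ⟨z, hz, hmax⟩ := (isCompact_range β.continuous).exists_isMaxOn (range_nonempty β)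
    (f := fun z => dist z q) (by fun_prop)
  exact ⟨dist z q, h hz, fun t ht w hw => lt_of_le_of_lt (hmax hw) ht⟩

/-- The cut-off groups are continuous from the left in `δ`. -/
theorem spanierGroup_cutoffSets_le_of_forall_lt {δ l R : ℝ} {x p : X} (hl : l < δ)
    {K : Subgroup (FundamentalGroup X p)}
    (h : ∀ t, l < t → t < δ → spanierGroup (cutoffSets t R x) p ≤ K) :
    spanierGroup (cutoffSets δ R x) p ≤ K := by
  rw [spanierGroup, Subgroup.closure_le]
  rintro _ ⟨q, σ, β, ⟨U, ⟨z, rfl⟩ | rfl, hβ⟩, rfl⟩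
  · obtain ⟨s, hs, hst⟩ := exists_lt_range_subset_ball hβ
    obtain ⟨t, ht, htδ⟩ := exists_between (max_lt hs hl)
    refine h t ((le_max_right _ _).trans_lt ht) htδ (Subgroup.subset_closure ?_)
    exact ⟨q, σ, β, ⟨_, Or.inl ⟨z, rfl⟩, hst t ((le_max_left _ _).trans_lt ht)⟩, rfl⟩
  · obtain ⟨t, ht, htδ⟩ := exists_between hl
    exact h t ht htδ (Subgroup.subset_closure ⟨q, σ, β, ⟨_, Or.inr rfl, hβ⟩, rfl⟩)

end Groups

/-! ### Cutting curves into pieces. -/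

section Subpaths

variable {X : Type u}

/-- The part of a path up to the parameter `t`. -/
def initialPath [TopologicalSpace X] {y z : X} (c : Path y z) (t : unitInterval) : Path y (c t) :=
  (c.subpath 0 t).cast c.source.symm rfl

/-- The part of a path after the parameter `t`. -/
def terminalPath [TopologicalSpace X] {y z : X} (c : Path y z) (t : unitInterval) :
    Path (c t) z :=
  (c.subpath t 1).cast rfl c.target.symm

theorem mk_initialPath_trans_subpath [TopologicalSpace X] {y z : X} (c : Path y z)
    (s t : unitInterval) :
    Path.Homotopic.Quotient.mk ((initialPath c s).trans (c.subpath s t)) =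
      Path.Homotopic.Quotient.mk (initialPath c t) := by
  have h : Path.Homotopic.Quotient.mk ((c.subpath 0 s).trans (c.subpath s t)) =
      Path.Homotopic.Quotient.mk (c.subpath 0 t) :=
    Path.Homotopic.Quotient.eq.2 ⟨Path.Homotopy.subpathTransSubpath c 0 s t⟩
  have h2 := congrArg (fun q => q.cast c.source.symm rfl) h
  exact h2

theorem mk_initialPath_trans_terminalPath [TopologicalSpace X] {y z : X} (c : Path y z)
    (t : unitInterval) :
    Path.Homotopic.Quotient.mk ((initialPath c t).trans (terminalPath c t)) =
      Path.Homotopic.Quotient.mk c := by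
  have h : Path.Homotopic.Quotient.mk ((c.subpath 0 t).trans (c.subpath t 1)) =
      Path.Homotopic.Quotient.mk (c.subpath 0 1) :=
    Path.Homotopic.Quotient.eq.2 ⟨Path.Homotopy.subpathTransSubpath c 0 t 1⟩
  rw [Path.subpath_zero_one] at h
  have h2 := congrArg (fun q => q.cast c.source.symm c.target.symm) h
  exact h2

theorem curveLength_subpath_le [PseudoEMetricSpace X] {y z : X} (c : Path y z)
    {s t : unitInterval} (h : s ≤ t) :
    curveLength (c.subpath s t) ≤ eVariationOn c (Icc s t) := by
  refine eVariationOn.comp_le_of_monotoneOn _ _ (fun a _ b _ hab => ?_)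
    (fun a _ => ⟨Icc.le_convexComb h a, Icc.convexComb_le h a⟩)
  have h' : (s : ℝ) ≤ t := h
  have hab' : (a : ℝ) ≤ b := hab
  rw [← Subtype.coe_le_coe, Icc.coe_convexComb, Icc.coe_convexComb]
  nlinarith

theorem curveLength_initialPath_add_terminalPath_le [PseudoEMetricSpace X] {y z : X}
    (c : Path y z) (t : unitInterval) :
    curveLength (initialPath c t) + curveLength (terminalPath c t) ≤ curveLength c := by
  have h := eVariationOn.Icc_add_Icc c (s := univ) (a := 0) (b := t) (c := 1)
    unitInterval.nonneg' unitInterval.le_one' (mem_univ _)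
  simp only [univ_inter] at h
  calc _ ≤ eVariationOn c (Icc 0 t) + eVariationOn c (Icc t 1) :=
        add_le_add (curveLength_subpath_le c unitInterval.nonneg')
          (curveLength_subpath_le c unitInterval.le_one')
    _ = eVariationOn c (Icc 0 1) := h
    _ ≤ curveLength c := eVariationOn.mono _ (subset_univ _)

theorem edist_le_curveLength [PseudoEMetricSpace X] {y z : X} (c : Path y z) :
    edist y z ≤ curveLength c := by
  have := eVariationOn.edist_le c (mem_univ (0 : unitInterval)) (mem_univ 1)
  rwa [c.source, c.target] at this

theorem range_subset_ball_of_curveLength_lt [MetricSpace X] {y z : X} (c : Path y z) {δ : ℝ}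
    (h : curveLength c < ENNReal.ofReal δ) : range c ⊆ Metric.ball y δ := by
  rintro _ ⟨t, rfl⟩
  have h1 := eVariationOn.edist_le c (mem_univ t) (mem_univ (0 : unitInterval))
  rw [c.source] at h1
  have h2 := h1.trans_lt h
  rw [edist_dist] at h2
  exact (ENNReal.ofReal_lt_ofReal_iff_of_nonneg dist_nonneg).1 h2

theorem IsLengthSpace.exists_curveLength_lt [MetricSpace X] (hX : IsLengthSpace X) {y z : X}
    {r : ENNReal} (h : edist y z < r) : ∃ c : Path y z, curveLength c < r := by
  rw [hX] at h
  exact iInf_lt_iff.1 h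

end Subpaths

/-! ### Path lifting and the local geometry of the covers. -/

namespace PathCover

section Topological

variable {X : Type u} [TopologicalSpace X] {p : X} (H : Subgroup (FundamentalGroup X p))

theorem exists_mk_eq (a : PathCover H) : ∃ (y : X) (γ : Path p y), mk H γ = a := by
  obtain ⟨⟨y, γ⟩, rfl⟩ := Quotient.exists_rep a
  exact ⟨y, γ, rfl⟩

theorem mk_trans_cast {y z w : X} (γ : Path p y) (c : Path y z) (h : w = z) :
    mk H (γ.trans (c.cast rfl h)) = mk H (γ.trans c) := by
  subst h
  rfl

/-- The lift of a path of `X` to the cover. -/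
noncomputable def lift {y z : X} (γ : Path p y) (c : Path y z) (t : unitInterval) : PathCover H :=
  mk H (γ.trans (initialPath c t))

theorem lift_zero {y z : X} (γ : Path p y) (c : Path y z) : lift H γ c 0 = mk H γ := by
  have h : initialPath c 0 = (Path.refl y).cast rfl c.source := by
    ext t
    simp [initialPath]
  rw [lift, h, mk_trans_cast]
  exact mk_eq_of_homotopic H (by simp)

theorem lift_one {y z : X} (γ : Path p y) (c : Path y z) :
    lift H γ c 1 = mk H (γ.trans c) := by
  have h : initialPath c 1 = c.cast rfl c.target := by
    ext t
    simp [initialPath]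
  rw [lift, h, mk_trans_cast]

theorem mk_lift_trans_subpath {y z : X} (γ : Path p y) (c : Path y z) (s t : unitInterval) :
    mk H ((γ.trans (initialPath c s)).trans (c.subpath s t)) = lift H γ c t := by
  refine mk_eq_of_homotopic H ?_
  rw [Path.Homotopic.Quotient.mk_trans, Path.Homotopic.Quotient.mk_trans,
    Path.Homotopic.Quotient.trans_assoc, ← Path.Homotopic.Quotient.mk_trans (initialPath c s),
    mk_initialPath_trans_subpath, ← Path.Homotopic.Quotient.mk_trans]

end Topological

section PseudoEMetric

variable {X : Type u} [PseudoEMetricSpace X] {p : X} (H : Subgroup (FundamentalGroup X p))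

theorem edist_mk_trans_le {y z : X} (γ : Path p y) (c : Path y z) :
    edist (mk H γ) (mk H (γ.trans c)) ≤ curveLength c :=
  coverEDist_le H γ c

theorem exists_curve_of_edist_lt {y : X} {γ : Path p y} {b : PathCover H} {r : ENNReal}
    (h : edist (mk H γ) b < r) :
    ∃ (z : X) (c : Path y z), mk H (γ.trans c) = b ∧ curveLength c < r := by
  change coverEDist H (mk H γ) b < r at h
  unfold coverEDist at h
  simp only [iInf_lt_iff] at h
  obtain ⟨y', z, γ', c, ha, hb, hc⟩ := h
  have hy : y' = y := congrArg (proj H) ha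
  subst hy
  exact ⟨z, c, by rw [← mk_trans_congr H ha c, hb], hc⟩

theorem edist_proj_le (a b : PathCover H) : edist (proj H a) (proj H b) ≤ edist a b := by
  refine le_coverEDist H ?_
  rintro y z γ c rfl rfl
  exact edist_le_curveLength c

theorem continuous_proj : Continuous (proj H) :=
  (LipschitzWith.of_edist_le (edist_proj_le H)).continuous

end PseudoEMetric

section Metric

variable {X : Type u} [MetricSpace X] {p : X} {H : Subgroup (FundamentalGroup X p)}

theorem exists_proj_eq_edist_lt (hX : IsLengthSpace X) {a : PathCover H} {z : X} {r : ENNReal}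
    (h : edist (proj H a) z < r) : ∃ b, proj H b = z ∧ edist a b < r := by
  obtain ⟨y, γ, rfl⟩ := exists_mk_eq H a
  obtain ⟨c, hc⟩ := hX.exists_curveLength_lt h
  exact ⟨mk H (γ.trans c), rfl, (edist_mk_trans_le H γ c).trans_lt hc⟩

variable {δ : ℝ}

/-- Adding a loop that lies in a small ball does not change a point of the cover. -/
theorem mk_trans_eq_of_range_subset (hH : deltaGroup δ p ≤ H) {y q : X} (γ : Path p y)
    (β : Path y y) (hβ : range β ⊆ Metric.ball q δ) : mk H (γ.trans β) = mk H γ := by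
  rw [mk_eq_mk_iff]
  exact hH (Subgroup.subset_closure ⟨y, γ, β, ⟨_, ⟨q, rfl⟩, hβ⟩, rfl⟩)

theorem mk_trans_eq_mk_trans (hH : deltaGroup δ p ≤ H) {y z q : X} (γ : Path p y)
    (c d : Path y z) (hc : range c ⊆ Metric.ball q δ) (hd : range d ⊆ Metric.ball q δ) :
    mk H (γ.trans c) = mk H (γ.trans d) := by
  have h1 := mk_trans_eq_of_range_subset hH γ (c.trans d.symm) (q := q) (by
    rw [Path.trans_range, Path.symm_range]
    exact union_subset hc hd)
  rw [← mk_trans_congr H h1 d]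
  refine mk_eq_of_homotopic H ?_
  simp [Path.Homotopic.Quotient.trans_assoc]

/-- The fibres of the cover are uniformly discrete. -/
theorem eq_of_proj_eq_of_edist_lt (hH : deltaGroup δ p ≤ H) {a b : PathCover H}
    (h : proj H a = proj H b) (hab : edist a b < ENNReal.ofReal δ) : a = b := by
  obtain ⟨y, γ, rfl⟩ := exists_mk_eq H a
  obtain ⟨z, c, rfl, hc⟩ := exists_curve_of_edist_lt H hab
  obtain rfl : y = z := h
  exact (mk_trans_eq_of_range_subset hH γ c (range_subset_ball_of_curveLength_lt c hc)).symm

/-- The curve `c` may have infinite length, so its own pieces do not bound distances in the cover.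
Near `s` a piece of `c` is replaced by a short curve with the same ends; both lie in one `δ`-ball,
so both lead to the same point of the cover. -/
theorem continuous_lift (hX : IsLengthSpace X) (hδ : 0 < δ) (hH : deltaGroup δ p ≤ H) {y z : X}
    (γ : Path p y) (c : Path y z) : Continuous (lift H γ c) := by
  rw [continuous_iff_continuousAt]
  intro s
  rw [ContinuousAt, EMetric.tendsto_nhds]
  intro ε hε
  set η : ENNReal := min ε (ENNReal.ofReal δ) with hη
  have hη0 : 0 < η := lt_min hε (ENNReal.ofReal_pos.2 hδ)
  have hηδ : η ≤ ENNReal.ofReal δ := min_le_right _ _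
  have hnear : ∀ᶠ t in 𝓝 s, ∀ r ∈ uIcc s t, c r ∈ Metric.eball (c s) η := by
    have hc : ContinuousAt c s := c.continuous.continuousAt
    have h1 : ∀ᶠ t in 𝓝 s, c t ∈ Metric.eball (c s) η := hc (Metric.eball_mem_nhds _ hη0)
    have h2 : Tendsto (fun t => uIcc s t) (𝓝 s) (𝓝 s).smallSets :=
      tendsto_const_nhds.uIcc tendsto_id
    exact h2.eventually (eventually_smallSets_forall.2 h1)
  filter_upwards [hnear] with t ht
  obtain ⟨d, hd⟩ := hX.exists_curveLength_lt
    (show edist (c s) (c t) < η by rw [edist_comm]; exact ht t right_mem_uIcc)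
  have hball : Metric.eball (c s) η ⊆ Metric.ball (c s) δ := by
    intro w hw
    have h2 : edist w (c s) < ENNReal.ofReal δ := lt_of_lt_of_le hw hηδ
    rw [edist_dist] at h2
    exact (ENNReal.ofReal_lt_ofReal_iff_of_nonneg dist_nonneg).1 h2
  have key : lift H γ c t = mk H ((γ.trans (initialPath c s)).trans d) := by
    rw [← mk_lift_trans_subpath H γ c s t]
    refine mk_trans_eq_mk_trans hH _ _ _ (q := c s) ?_
      (range_subset_ball_of_curveLength_lt d (hd.trans_le hηδ))
    rw [Path.range_subpath]
    rintro _ ⟨r, hr, rfl⟩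
    exact hball (ht r hr)
  rw [key, edist_comm]
  exact ((edist_mk_trans_le H _ d).trans_lt hd).trans_le (min_le_left _ _)

/-- A representing path need not be rectifiable. Its lift is continuous, however, and the parameters
at finite distance from the base point form a nonempty clopen subset of the interval. -/
theorem edist_ne_top (hX : IsLengthSpace X) (hδ : 0 < δ) (hH : deltaGroup δ p ≤ H)
    (a b : PathCover H) : edist a b ≠ ⊤ := by
  have key : ∀ a : PathCover H, edist (base H) a < ⊤ := by
    intro a
    obtain ⟨y, γ, rfl⟩ := exists_mk_eq H a
    have hc := continuous_lift hX hδ hH (Path.refl p) γ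
    have hclopen : IsClopen {t | edist (base H) (lift H (Path.refl p) γ t) < ⊤} := by
      constructor
      · rw [← isOpen_compl_iff, isOpen_iff_mem_nhds]
        intro s hs
        have : ∀ᶠ t in 𝓝 s, edist (lift H (Path.refl p) γ t) (lift H (Path.refl p) γ s) < 1 :=
          hc.continuousAt (Metric.eball_mem_nhds _ one_pos)
        filter_upwards [this] with t ht ht'
        exact hs ((edist_triangle _ _ _).trans_lt
          (ENNReal.add_lt_top.2 ⟨ht', ht.trans ENNReal.one_lt_top⟩))
      · rw [isOpen_iff_mem_nhds]
        intro s hs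
        have : ∀ᶠ t in 𝓝 s, edist (lift H (Path.refl p) γ t) (lift H (Path.refl p) γ s) < 1 :=
          hc.continuousAt (Metric.eball_mem_nhds _ one_pos)
        filter_upwards [this] with t ht
        rw [edist_comm] at ht
        exact (edist_triangle _ _ _).trans_lt
          (ENNReal.add_lt_top.2 ⟨hs, ht.trans ENNReal.one_lt_top⟩)
    have huniv := hclopen.eq_univ ⟨0, by
      rw [mem_ofPred_eq, lift_zero, base, edist_self]
      exact ENNReal.zero_lt_top⟩
    have h1 : (1 : unitInterval) ∈ {t | edist (base H) (lift H (Path.refl p) γ t) < ⊤} := by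
      rw [huniv]; trivial
    rw [mem_ofPred_eq, lift_one, mk_eq_of_homotopic H (γ := (Path.refl p).trans γ) (σ := γ)
      (by simp)] at h1
    exact h1
  refine ((edist_triangle a (base H) b).trans_lt (ENNReal.add_lt_top.2 ⟨?_, key b⟩)).ne
  rw [edist_comm]
  exact key a

theorem eq_of_edist_eq_zero (hδ : 0 < δ) (hH : deltaGroup δ p ≤ H) {a b : PathCover H}
    (h : edist a b = 0) : a = b := by
  refine eq_of_proj_eq_of_edist_lt hH ?_ (by rw [h]; exact ENNReal.ofReal_pos.2 hδ)
  exact edist_le_zero.1 ((edist_proj_le H a b).trans_eq h)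

/-- The length metric of a cover of a length space that is finer than a `δ`-cover is a metric. -/
noncomputable abbrev metricSpace (hX : IsLengthSpace X) (hδ : 0 < δ) (hH : deltaGroup δ p ≤ H) :
    MetricSpace (PathCover H) :=
  letI : EMetricSpace (PathCover H) :=
    { instPseudoEMetricSpace H with
      eq_of_edist_eq_zero := eq_of_edist_eq_zero hδ hH }
  EMetricSpace.toMetricSpace (edist_ne_top hX hδ hH)

/-- On small scales, the projection is an isometry. -/
theorem edist_eq_edist_proj (hX : IsLengthSpace X) (hH : deltaGroup δ p ≤ H)
    {a b : PathCover H} {η : ENNReal} (hη : η + η ≤ ENNReal.ofReal δ) (hab : edist a b < η) :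
    edist a b = edist (proj H a) (proj H b) := by
  refine le_antisymm ?_ (edist_proj_le H a b)
  refine le_of_forall_gt fun r hr => ?_
  obtain ⟨b', hb', hab'⟩ := exists_proj_eq_edist_lt hX
    (lt_min hr ((edist_proj_le H a b).trans_lt hab))
  have : b' = b := by
    refine eq_of_proj_eq_of_edist_lt hH hb' (lt_of_lt_of_le ?_ hη)
    refine (edist_triangle b' a b).trans_lt (ENNReal.add_lt_add ?_ hab)
    rw [edist_comm]
    exact hab'.trans_le (min_le_right _ _)
  exact this ▸ hab'.trans_le (min_le_left _ _)

/-- Approximate intermediate points. -/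
theorem exists_edist_le_edist_lt (hX : IsLengthSpace X) (hδ : 0 < δ) (hH : deltaGroup δ p ≤ H)
    {a b : PathCover H} {s t : ENNReal} (ht : 0 < t) (h : edist a b < s + t) :
    ∃ z, edist a z ≤ s ∧ edist z b < t := by
  rcases le_total (edist a b) s with hs | hs
  · exact ⟨b, hs, by rwa [edist_self]⟩
  obtain ⟨y, γ, rfl⟩ := exists_mk_eq H a
  obtain ⟨w, c, rfl, hc⟩ := exists_curve_of_edist_lt H h
  have hcont : Continuous fun r => edist (mk H γ) (lift H γ c r) :=
    continuous_const.edist (continuous_lift hX hδ hH γ c)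
  obtain ⟨r, hr⟩ := mem_range_of_exists_le_of_exists_ge hcont
    (c := s) ⟨0, by rw [lift_zero, edist_self]; exact zero_le⟩ ⟨1, by rwa [lift_one]⟩
  refine ⟨lift H γ c r, hr.le, ?_⟩
  -- The curve is cut where its distance from `a` equals `s`. The first piece has length at least
  -- `s`, which leaves less than `t` for the second.
  have h1 : s ≤ curveLength (initialPath c r) := hr ▸ edist_mk_trans_le H γ (initialPath c r)
  have h2 : edist (lift H γ c r) (mk H (γ.trans c)) ≤ curveLength (terminalPath c r) := by
    have h3 := edist_mk_trans_le H (γ.trans (initialPath c r)) (terminalPath c r)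
    rwa [mk_eq_of_homotopic H
      (γ := (γ.trans (initialPath c r)).trans (terminalPath c r)) (σ := γ.trans c)] at h3
    rw [Path.Homotopic.Quotient.mk_trans, Path.Homotopic.Quotient.mk_trans,
      Path.Homotopic.Quotient.trans_assoc, ← Path.Homotopic.Quotient.mk_trans (initialPath c r),
      mk_initialPath_trans_terminalPath, ← Path.Homotopic.Quotient.mk_trans]
  have h4 : s + curveLength (terminalPath c r) < s + t :=
    ((add_le_add_left h1 _).trans (curveLength_initialPath_add_terminalPath_le c r)).trans_lt hc
  exact h2.trans_lt (lt_of_add_lt_add_left h4)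

end Metric

end PathCover

/-! ### The Hopf-Rinow theorem for length spaces. -/

section HopfRinow

/-- The Hopf-Rinow theorem: a complete locally compact space with approximate intermediate points
is proper. -/
theorem properSpace_of_exists_between {E : Type u} [MetricSpace E] [CompleteSpace E]
    [LocallyCompactSpace E]
    (h : ∀ (a b : E) (s t : ENNReal), 0 < t → edist a b < s + t →
      ∃ z, edist a z ≤ s ∧ edist z b < t) : ProperSpace E := by
  have hmid : ∀ (a b : E) (s t : ℝ), 0 ≤ s → 0 < t → dist a b < s + t →
      ∃ z, dist a z ≤ s ∧ dist z b < t := by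
    intro a b s t hs ht hab
    obtain ⟨z, h1, h2⟩ := h a b (ENNReal.ofReal s) (ENNReal.ofReal t) (ENNReal.ofReal_pos.2 ht)
      (by rw [← ENNReal.ofReal_add hs ht.le, edist_lt_ofReal]; exact hab)
    exact ⟨z, (edist_le_ofReal hs).1 h1, edist_lt_ofReal.1 h2⟩
  refine ⟨fun e r₀ => ?_⟩
  by_contra hr₀
  set S : Set ℝ := {r | IsCompact (Metric.closedBall e r)} with hS
  have hdown : ∀ r ∈ S, ∀ r' ≤ r, r' ∈ S := fun r hr r' hr' =>
    IsCompact.of_isClosed_subset hr Metric.isClosed_closedBall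
      (Metric.closedBall_subset_closedBall hr')
  have hbdd : BddAbove S := ⟨r₀, fun r hr => by
    by_contra! hlt
    exact hr₀ (hdown r hr r₀ hlt.le)⟩
  have h0 : (0 : ℝ) ∈ S := by
    change IsCompact (Metric.closedBall e 0)
    rw [Metric.closedBall_zero]
    exact isCompact_singleton
  have hρ0 : 0 ≤ sSup S := le_csSup hbdd h0
  -- The supremum is attained: an `ε / 2`-net of a slightly smaller compact ball is an `ε`-net of
  -- this one, by intermediate points.
  have hρ : IsCompact (Metric.closedBall e (sSup S)) := by
    rw [isCompact_iff_totallyBounded_isComplete]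
    refine ⟨?_, Metric.isClosed_closedBall.isComplete⟩
    rw [Metric.totallyBounded_iff]
    intro ε hε
    obtain ⟨r, hr, hrlt⟩ := exists_lt_of_lt_csSup ⟨0, h0⟩ (sub_lt_self (sSup S) (half_pos hε))
    obtain ⟨r', hr', hr'0, hrr'⟩ : ∃ r' ∈ S, 0 ≤ r' ∧ r ≤ r' := by
      rcases le_total r 0 with h | h
      · exact ⟨0, h0, le_rfl, h⟩
      · exact ⟨r, hr, h, le_rfl⟩
    obtain ⟨t, ht, htc⟩ := Metric.totallyBounded_iff.1 (IsCompact.totallyBounded hr') (ε / 2)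
      (half_pos hε)
    refine ⟨t, ht, fun b hb => ?_⟩
    obtain ⟨z, hz, hzb⟩ := hmid e b r' (ε / 2) hr'0 (half_pos hε) (by
      rw [dist_comm]
      have := Metric.mem_closedBall.1 hb
      linarith)
    obtain ⟨w, hw, hzw⟩ := mem_iUnion₂.1 (htc (Metric.mem_closedBall'.2 hz))
    refine mem_iUnion₂.2 ⟨w, hw, ?_⟩
    rw [Metric.mem_ball] at hzw ⊢
    have := dist_triangle_left b w z
    linarith
  -- By local compactness some closed thickening of the maximal ball is still compact. It contains a
  -- larger closed ball, which contradicts maximality.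
  obtain ⟨η, hη, hcomp⟩ := hρ.exists_isCompact_cthickening
  have hmem : sSup S + η / 2 ∈ S := by
    refine IsCompact.of_isClosed_subset hcomp Metric.isClosed_closedBall fun b hb => ?_
    obtain ⟨z, hz, hzb⟩ := hmid e b (sSup S) η hρ0 hη (by
      rw [dist_comm]
      have := Metric.mem_closedBall.1 hb
      linarith)
    refine Metric.thickening_subset_cthickening _ _ (Metric.mem_thickening_iff.2 ⟨z, ?_, ?_⟩)
    · exact Metric.mem_closedBall'.2 hz
    · rwa [dist_comm]
  have := le_csSup hbdd hmem
  linarith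

theorem IsLengthSpace.exists_between {X : Type u} [MetricSpace X] (hX : IsLengthSpace X)
    (a b : X) (s t : ENNReal) (ht : 0 < t) (h : edist a b < s + t) :
    ∃ z, edist a z ≤ s ∧ edist z b < t := by
  rcases le_total (edist a b) s with hs | hs
  · exact ⟨b, hs, by rwa [edist_self]⟩
  obtain ⟨c, hc⟩ := hX.exists_curveLength_lt h
  have hcont : Continuous fun r => edist a (c r) := continuous_const.edist c.continuous
  obtain ⟨r, hr⟩ := mem_range_of_exists_le_of_exists_ge hcont
    (c := s) ⟨0, by rw [c.source, edist_self]; exact zero_le⟩ ⟨1, by rwa [c.target]⟩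
  refine ⟨c r, hr.le, ?_⟩
  have h1 : s ≤ curveLength (initialPath c r) := hr ▸ edist_le_curveLength (initialPath c r)
  have h4 : s + curveLength (terminalPath c r) < s + t :=
    ((add_le_add_left h1 _).trans (curveLength_initialPath_add_terminalPath_le c r)).trans_lt hc
  exact (edist_le_curveLength (terminalPath c r)).trans_lt (lt_of_add_lt_add_left h4)

theorem IsLengthSpace.properSpace {X : Type u} [MetricSpace X] [CompleteSpace X]
    [LocallyCompactSpace X] (hX : IsLengthSpace X) : ProperSpace X :=
  properSpace_of_exists_between hX.exists_between

end HopfRinow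

/-! ### Properness of the covers. -/

namespace PathCover

variable {X : Type u} [MetricSpace X] {p : X} {H : Subgroup (FundamentalGroup X p)} {δ : ℝ}

/-- Over the compact ball `K`, the points within `δ / 4` of `a` give a section of the projection.
Its values are less than `δ / 2` apart, a scale at which the projection is isometric, so the section
is continuous and its image compact. By discreteness of the fibres this image contains the ball
around `a`. -/
theorem isCompact_setOf_edist_le [ProperSpace X] (hX : IsLengthSpace X) (hδ : 0 < δ)
    (hH : deltaGroup δ p ≤ H) (a : PathCover H) :
    IsCompact {b | edist b a ≤ ENNReal.ofReal (δ / 8)} := by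
  set K := Metric.closedBall (proj H a) (δ / 8) with hK
  have hlt : ENNReal.ofReal (δ / 8) < ENNReal.ofReal (δ / 4) :=
    (ENNReal.ofReal_lt_ofReal_iff (by positivity)).2 (by linarith)
  have hex : ∀ z ∈ K, ∃ b, proj H b = z ∧ edist a b < ENNReal.ofReal (δ / 4) := by
    intro z hz
    refine exists_proj_eq_edist_lt hX (lt_of_le_of_lt ?_ hlt)
    rw [edist_comm]
    exact (edist_le_ofReal (by positivity)).2 hz
  have : Nonempty (PathCover H) := ⟨a⟩
  choose! s hs1 hs2 using hex
  have hiso : ∀ z ∈ K, ∀ w ∈ K, edist (s z) (s w) = edist z w := by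
    intro z hz w hw
    have h1 : edist (s z) (s w) < ENNReal.ofReal (δ / 2) := by
      refine (edist_triangle (s z) a (s w)).trans_lt ?_
      rw [show δ / 2 = δ / 4 + δ / 4 by ring, ENNReal.ofReal_add (by positivity) (by positivity)]
      refine ENNReal.add_lt_add ?_ (hs2 w hw)
      rw [edist_comm]
      exact hs2 z hz
    rw [edist_eq_edist_proj hX hH (by rw [← ENNReal.ofReal_add (by positivity) (by positivity),
      add_halves]) h1, hs1 z hz, hs1 w hw]
  have hcont : ContinuousOn s K := by
    have : LipschitzOnWith 1 s K := fun z hz w hw => by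
      rw [hiso z hz w hw, ENNReal.coe_one, one_mul]
    exact this.continuousOn
  refine ((isCompact_closedBall _ _).image_of_continuousOn hcont).of_isClosed_subset
    (isClosed_le (continuous_id.edist continuous_const) continuous_const) fun b hb => ?_
  have hbK : proj H b ∈ K := by
    rw [hK, Metric.mem_closedBall, ← edist_le_ofReal (by positivity)]
    exact (edist_proj_le H b a).trans hb
  refine ⟨proj H b, hbK, eq_of_proj_eq_of_edist_lt hH (hs1 _ hbK) ?_⟩
  refine (edist_triangle _ a _).trans_lt ?_
  have h1 : edist a b ≤ ENNReal.ofReal (δ / 8) := by rw [edist_comm]; exact hb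
  have h2 : edist (s (proj H b)) a < ENNReal.ofReal (δ / 4) := by
    rw [edist_comm]; exact hs2 _ hbK
  calc _ < ENNReal.ofReal (δ / 4) + ENNReal.ofReal (δ / 4) :=
        ENNReal.add_lt_add h2 (h1.trans_lt hlt)
    _ = ENNReal.ofReal (δ / 2) := by
        rw [← ENNReal.ofReal_add (by positivity) (by positivity)]
        congr 1
        ring
    _ ≤ ENNReal.ofReal δ := ENNReal.ofReal_le_ofReal (by linarith)

/-- The radius `δ / 8` of the compact balls does not depend on the centre. This gives completeness
as well as local compactness, so Hopf-Rinow applies. -/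
theorem properSpace [ProperSpace X] (hX : IsLengthSpace X) (hδ : 0 < δ)
    (hH : deltaGroup δ p ≤ H) :
    @ProperSpace (PathCover H) (metricSpace hX hδ hH).toPseudoMetricSpace := by
  let _ := metricSpace hX hδ hH
  have hball : ∀ a : PathCover H, IsCompact (Metric.closedBall a (δ / 8)) := by
    intro a
    have : Metric.closedBall a (δ / 8) = {b | edist b a ≤ ENNReal.ofReal (δ / 8)} := by
      ext b
      rw [Metric.mem_closedBall, ← edist_le_ofReal (by positivity), mem_ofPred_eq]
    rw [this]
    exact isCompact_setOf_edist_le hX hδ hH a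
  have : WeaklyLocallyCompactSpace (PathCover H) :=
    ⟨fun a => ⟨_, hball a, Metric.closedBall_mem_nhds a (by positivity)⟩⟩
  have : CompleteSpace (PathCover H) := by
    refine Metric.complete_of_cauchySeq_tendsto fun u hu => ?_
    obtain ⟨N, hN⟩ := Metric.cauchySeq_iff'.1 hu (δ / 8) (by positivity)
    obtain ⟨a, -, ha⟩ := cauchySeq_tendsto_of_isComplete (hball (u N)).isComplete
      (u := fun n => u (n + N)) (fun n => (hN _ (Nat.le_add_left N n)).le)
      (hu.comp_tendsto (tendsto_add_atTop_nat N))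
    exact ⟨a, (tendsto_add_atTop_iff_nat N).1 ha⟩
  exact properSpace_of_exists_between fun a b s t ht h =>
    exists_edist_le_edist_lt hX hδ hH ht h

end PathCover

/-! ### Stabilization for large `R` and existence of the limit. -/

namespace PathCover

section Map

variable {X : Type u} {p : X}

theorem mk_eq_base_iff [TopologicalSpace X] (H : Subgroup (FundamentalGroup X p))
    (c : Path p p) : mk H c = base H ↔ loopClass c ∈ H := by
  rw [base, mk_eq_mk_iff, loopClass_congr (d := c) (by simp)]

/-- The map between the covers given by two subgroups `H ≤ K`. -/
def mapOfLE [TopologicalSpace X] {H K : Subgroup (FundamentalGroup X p)} (h : H ≤ K) :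
    PathCover H → PathCover K :=
  Quotient.map' id fun _ _ hab => ⟨hab.1, h hab.2⟩

theorem mapOfLE_mk [TopologicalSpace X] {H K : Subgroup (FundamentalGroup X p)} (h : H ≤ K)
    {y : X} (γ : Path p y) : mapOfLE h (mk H γ) = mk K γ := rfl

theorem proj_mapOfLE [TopologicalSpace X] {H K : Subgroup (FundamentalGroup X p)} (h : H ≤ K)
    (a : PathCover H) : proj K (mapOfLE h a) = proj H a := by
  obtain ⟨y, γ, rfl⟩ := exists_mk_eq H a
  rfl

theorem mk_eq_mk_of_le [TopologicalSpace X] {H K : Subgroup (FundamentalGroup X p)} (h : H ≤ K)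
    {y : X} {γ σ : Path p y} (e : mk H γ = mk H σ) : mk K γ = mk K σ :=
  congrArg (mapOfLE h) e

theorem edist_mapOfLE_le [PseudoEMetricSpace X] {H K : Subgroup (FundamentalGroup X p)}
    (h : H ≤ K) (a b : PathCover H) : edist (mapOfLE h a) (mapOfLE h b) ≤ edist a b := by
  refine le_coverEDist H ?_
  rintro y z γ c rfl rfl
  exact edist_mk_trans_le K γ c

theorem exists_mk_eq_of_edist_base_lt [PseudoEMetricSpace X]
    {H : Subgroup (FundamentalGroup X p)} {a : PathCover H} {r : ENNReal}
    (h : edist a (base H) < r) : ∃ (y : X) (c : Path p y), mk H c = a ∧ curveLength c < r := by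
  rw [edist_comm] at h
  obtain ⟨y, c, rfl, hc⟩ := exists_curve_of_edist_lt H h
  exact ⟨y, c, mk_eq_of_homotopic H (by simp), hc⟩

theorem edist_mk_base_le [PseudoEMetricSpace X] (H : Subgroup (FundamentalGroup X p)) {y : X}
    (c : Path p y) : edist (mk H c) (base H) ≤ curveLength c := by
  rw [edist_comm, mk_eq_of_homotopic H (γ := c) (σ := (Path.refl p).trans c) (by simp)]
  exact edist_mk_trans_le H _ c

end Map

section Stabilization

variable {X : Type u} [MetricSpace X] {p : X} {δ : ℝ}

/-- Finitely many balls of radius `δ / 2` cover the compact ball, and each contains at most one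
point of the fibre. -/
theorem finite_fiber_inter_closedBall [ProperSpace X] (hX : IsLengthSpace X) (hδ : 0 < δ)
    {H : Subgroup (FundamentalGroup X p)} (hH : deltaGroup δ p ≤ H) (q : X) (L : ℝ) :
    {z : PathCover H | proj H z = q ∧ edist z (base H) < ENNReal.ofReal L}.Finite := by
  let _ := metricSpace hX hδ hH
  have := properSpace hX hδ hH
  obtain ⟨t, ht, hcov⟩ := Metric.totallyBounded_iff.1
    (isCompact_closedBall (base H) L).totallyBounded (δ / 2) (half_pos hδ)
  have hex : ∀ z ∈ {z : PathCover H | proj H z = q ∧ edist z (base H) < ENNReal.ofReal L},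
      ∃ w ∈ t, dist z w < δ / 2 := by
    rintro z ⟨-, hz⟩
    rw [edist_lt_ofReal] at hz
    exact mem_iUnion₂.1 (hcov (Metric.mem_closedBall.2 hz.le)) |>.imp fun w hw => ⟨hw.1, hw.2⟩
  have : Nonempty (PathCover H) := ⟨base H⟩
  choose! w hw1 hw2 using hex
  refine Finite.of_injOn (f := w) (fun z hz => hw1 z hz) (fun z hz z' hz' hzz' => ?_) ht
  refine eq_of_proj_eq_of_edist_lt hH (hz.1.trans hz'.1.symm) ?_
  rw [edist_lt_ofReal]
  have h1 := hw2 z hz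
  have h2 := hw2 z' hz'
  rw [← hzz'] at h2
  have := dist_triangle_right z z' (w z)
  linarith

/-- For large `R`, a loop of bounded length that is trivial in the `R` cut-off cover is trivial in
all cut-off covers. -/
theorem eventually_mem_limitGroup [ProperSpace X] (hX : IsLengthSpace X) (hδ : 0 < δ) (x : X)
    (L : ℝ) : ∀ᶠ R in atTop, ∀ c : Path p p, curveLength c < ENNReal.ofReal L →
      loopClass c ∈ spanierGroup (cutoffSets δ R x) p → loopClass c ∈ limitGroup δ x p := by
  set H := limitGroup δ x p with hH
  have hfin := finite_fiber_inter_closedBall hX hδ (deltaGroup_le_limitGroup δ x p) p L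
  have key : ∀ z ∈ {z : PathCover H | proj H z = p ∧ edist z (base H) < ENNReal.ofReal L},
      ∀ᶠ R in atTop, ∀ c : Path p p, mk H c = z →
        loopClass c ∈ spanierGroup (cutoffSets δ R x) p → loopClass c ∈ H := by
    intro z _
    -- Membership in any group containing `H` depends only on the point `z` that a loop represents.
    -- If a loop over `z` is outside `H`, it is outside the group of some `R₀`, hence outside those
    -- of all `R ≥ R₀`.
    by_cases hz : ∃ c₀ : Path p p, mk H c₀ = z ∧ loopClass c₀ ∉ H
    · obtain ⟨c₀, rfl, hc₀⟩ := hz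
      rw [hH, limitGroup, Subgroup.mem_iInf, not_forall] at hc₀
      obtain ⟨R₀, hR₀⟩ := hc₀
      filter_upwards [eventually_ge_atTop R₀] with R hR c hc hcR
      refine absurd ?_ hR₀
      refine spanierGroup_cutoffSets_le_of_closedBall_subset
        (Metric.closedBall_subset_closedBall hR) p ?_
      rw [← mk_eq_base_iff] at hcR ⊢
      rw [← hcR]
      exact (mk_eq_mk_of_le (limitGroup_le δ R x p) hc).symm
    · push Not at hz
      exact Eventually.of_forall fun R c hc _ => hz c hc
  filter_upwards [(eventually_all_finite hfin).2 key] with R hR c hc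
  exact hR (mk H c) ⟨rfl, (edist_mk_base_le H c).trans_lt hc⟩ c rfl

/-- For large `R`, the map from the limit cover to the `R` cut-off cover is isometric on bounded
sets. -/
theorem eventually_edist_mapOfLE_eq [ProperSpace X] (hX : IsLengthSpace X) (hδ : 0 < δ) (x : X)
    {r : ℝ} (hr : 0 ≤ r) : ∀ᶠ R in atTop, ∀ a b : PathCover (limitGroup δ x p),
      edist a (base _) ≤ ENNReal.ofReal r → edist b (base _) ≤ ENNReal.ofReal r →
      edist (mapOfLE (limitGroup_le δ R x p) a) (mapOfLE (limitGroup_le δ R x p) b) =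
        edist a b := by
  -- The loop to be controlled is `c e d⁻¹`: `c` and `d` represent `a` and `b` and are shorter than
  -- `r + 1`, and `e` joins their images and is shorter than `2 * r + 1`.
  filter_upwards [eventually_mem_limitGroup (p := p) hX hδ x
    ((r + 1) + (2 * r + 1) + (r + 1))] with R hR a b ha hb
  refine le_antisymm (edist_mapOfLE_le _ a b) (le_of_forall_gt fun s hs => ?_)
  have hlt : ENNReal.ofReal r < ENNReal.ofReal (r + 1) :=
    (ENNReal.ofReal_lt_ofReal_iff (by positivity)).2 (by linarith)
  obtain ⟨y, c, rfl, hc⟩ := exists_mk_eq_of_edist_base_lt (ha.trans_lt hlt)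
  obtain ⟨z, d, rfl, hd⟩ := exists_mk_eq_of_edist_base_lt (hb.trans_lt hlt)
  rw [mapOfLE_mk, mapOfLE_mk] at hs
  have h2r : edist (mk (limitGroup δ x p) c) (mk (limitGroup δ x p) d) <
      ENNReal.ofReal (2 * r + 1) := by
    refine (edist_triangle_right _ _ (base _)).trans_lt ((add_le_add ha hb).trans_lt ?_)
    rw [← ENNReal.ofReal_add hr hr, ENNReal.ofReal_lt_ofReal_iff (by positivity)]
    linarith
  obtain ⟨w, e, he, hes⟩ := exists_curve_of_edist_lt _ (lt_min hs
    ((edist_mapOfLE_le (limitGroup_le δ R x p) (mk _ c) (mk _ d)).trans_lt h2r))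
  obtain rfl : w = z := congrArg (proj _) he
  have hlen : curveLength ((c.trans e).trans d.symm) <
      ENNReal.ofReal ((r + 1) + (2 * r + 1) + (r + 1)) := by
    refine (curveLength_trans_le _ _).trans_lt ?_
    rw [ENNReal.ofReal_add (by positivity) (by positivity),
      ENNReal.ofReal_add (by positivity) (by positivity)]
    refine ENNReal.add_lt_add ((curveLength_trans_le _ _).trans_lt (ENNReal.add_lt_add hc
      (hes.trans_le (min_le_right _ _)))) ((curveLength_symm_le d).trans_lt hd)
  rw [mk_eq_mk_iff] at he
  rw [← (mk_eq_mk_iff _ _ _).2 (hR _ hlen he)]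
  exact (edist_mk_trans_le _ c e).trans_lt (hes.trans_le (min_le_left _ _))

/-- A representing curve only gives a preimage at distance at most `r + 1`; isometry on that larger
ball brings the bound back to exactly `r`. -/
theorem eventually_exists_mapOfLE_eq [ProperSpace X] (hX : IsLengthSpace X) (hδ : 0 < δ) (x : X)
    {r : ℝ} (hr : 0 ≤ r) : ∀ᶠ R in atTop, ∀ a' : PathCover (spanierGroup (cutoffSets δ R x) p),
      edist a' (base _) ≤ ENNReal.ofReal r →
      ∃ a : PathCover (limitGroup δ x p), edist a (base _) ≤ ENNReal.ofReal r ∧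
        mapOfLE (limitGroup_le δ R x p) a = a' := by
  filter_upwards [eventually_edist_mapOfLE_eq (p := p) hX hδ x
    (show 0 ≤ r + 1 by positivity)] with R hR a' ha'
  obtain ⟨y, c, rfl, hc⟩ := exists_mk_eq_of_edist_base_lt (ha'.trans_lt
    ((ENNReal.ofReal_lt_ofReal_iff (by positivity)).2 (lt_add_one r)))
  refine ⟨mk _ c, ?_, rfl⟩
  have h := hR (mk _ c) (base _) ((edist_mk_base_le _ c).trans hc.le) (by
    rw [edist_self]; exact zero_le)
  rw [← h]
  exact ha'

/-- For large `R` the approximation is exact: on the ball of radius `r` it is the inverse of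
`mapOfLE`. -/
theorem isCutoffLimit [ProperSpace X] (hX : IsLengthSpace X) (hδ : 0 < δ) (x : X) :
    @IsCutoffLimit X _ δ x (PathCover (limitGroup δ x x))
      (metricSpace hX hδ (deltaGroup_le_limitGroup δ x x)) (base _) (proj _) := by
  let _ := metricSpace hX hδ (deltaGroup_le_limitGroup δ x x)
  have := properSpace hX hδ (deltaGroup_le_limitGroup δ x x)
  refine ⟨inferInstance, continuous_proj _, fun r hr ε hε => ?_⟩
  filter_upwards [eventually_edist_mapOfLE_eq (p := x) hX hδ x hr.le,
    eventually_exists_mapOfLE_eq (p := x) hX hδ x hr.le] with R hiso hsurj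
  have hex : ∀ a' : PathCover (cutoffGroup δ R x), ∃ a : PathCover (limitGroup δ x x),
      edist a' (base _) ≤ ENNReal.ofReal r →
        edist a (base _) ≤ ENNReal.ofReal r ∧ mapOfLE (limitGroup_le δ R x x) a = a' := by
    intro a'
    by_cases h : edist a' (base _) ≤ ENNReal.ofReal r
    · obtain ⟨a, ha⟩ := hsurj a' h
      exact ⟨a, fun _ => ha⟩
    · exact ⟨base _, fun h' => absurd h' h⟩
  choose f hf using hex
  have hb : edist (base (limitGroup δ x x)) (base _) ≤ ENNReal.ofReal r := by
    rw [edist_self]; exact zero_le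
  have hfiso : ∀ a b, edist a (base _) ≤ ENNReal.ofReal r →
      edist b (base _) ≤ ENNReal.ofReal r → edist (f a) (f b) = edist a b := by
    intro a b ha hb
    rw [← hiso _ _ (hf a ha).1 (hf b hb).1, (hf a ha).2, (hf b hb).2]
    rfl
  have hfinv : ∀ a, edist a (base _) ≤ ENNReal.ofReal r →
      f (mapOfLE (limitGroup_le δ R x x) a) = a := by
    intro a ha
    have h1 := hf (mapOfLE (limitGroup_le δ R x x) a)
      ((edist_mapOfLE_le (limitGroup_le δ R x x) a (base _)).trans ha)
    refine edist_eq_zero.1 ?_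
    rw [← hiso _ _ h1.1 ha, h1.2]
    exact edist_self _
  refine ⟨f, hfinv _ hb, fun a ha => (hf a ha).1, fun a b ha hb => ?_, fun z hz => ?_,
    fun a ha => ?_⟩
  · rw [hfiso a b ha hb]
    exact ⟨le_self_add, le_self_add⟩
  · refine ⟨mapOfLE (limitGroup_le δ R x x) z,
      (edist_mapOfLE_le (limitGroup_le δ R x x) z (base _)).trans hz, ?_⟩
    rw [hfinv z hz, edist_self]
    exact zero_le
  · have h1 := proj_mapOfLE (limitGroup_le δ R x x) (f a)
    rw [(hf a ha).2] at h1
    rw [← h1]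
    exact (edist_self _).trans_le zero_le

end Stabilization

end PathCover

/-! ### Uniqueness of pointed Gromov-Hausdorff limits over `X`. -/

section GromovHausdorff

/-- `f` is an `ε`-Hausdorff approximation between the closed balls of radius `r` around `e` and
`y`, compatible up to `ε` with the maps to `X`. -/
structure IsApproximation {E Y X : Type u} [PseudoEMetricSpace E] [MetricSpace Y]
    [MetricSpace X] (e : E) (y : Y) (π : E → X) (h : Y → X) (r ε : ℝ) (f : E → Y) : Prop where
  map_base : f e = y
  edist_le : ∀ a b, edist a e ≤ ENNReal.ofReal r → edist b e ≤ ENNReal.ofReal r →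
    edist (f a) (f b) ≤ edist a b + ENNReal.ofReal ε ∧
      edist a b ≤ edist (f a) (f b) + ENNReal.ofReal ε
  exists_edist_le : ∀ z, edist z y ≤ ENNReal.ofReal r →
    ∃ a, edist a e ≤ ENNReal.ofReal r ∧ edist z (f a) ≤ ENNReal.ofReal ε
  edist_proj_le : ∀ a, edist a e ≤ ENNReal.ofReal r → edist (h (f a)) (π a) ≤ ENNReal.ofReal ε

variable {E Y X : Type u} [MetricSpace E] [MetricSpace Y] [MetricSpace X] {e : E} {y : Y}
  {π : E → X} {h : Y → X} {r ε : ℝ} {f : E → Y}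

namespace IsApproximation

theorem dist_map_le (hf : IsApproximation e y π h r ε f) (hr : 0 ≤ r) (hε : 0 ≤ ε) {a b : E}
    (ha : dist a e ≤ r) (hb : dist b e ≤ r) : dist (f a) (f b) ≤ dist a b + ε := by
  have := (hf.edist_le a b ((edist_le_ofReal hr).2 ha) ((edist_le_ofReal hr).2 hb)).1
  rwa [edist_dist a b, ← ENNReal.ofReal_add dist_nonneg hε,
    edist_le_ofReal (by positivity)] at this

theorem dist_le_map (hf : IsApproximation e y π h r ε f) (hr : 0 ≤ r) (hε : 0 ≤ ε) {a b : E}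
    (ha : dist a e ≤ r) (hb : dist b e ≤ r) : dist a b ≤ dist (f a) (f b) + ε := by
  have := (hf.edist_le a b ((edist_le_ofReal hr).2 ha) ((edist_le_ofReal hr).2 hb)).2
  rwa [edist_dist (f a), ← ENNReal.ofReal_add dist_nonneg hε,
    edist_le_ofReal (by positivity)] at this

theorem exists_dist_le (hf : IsApproximation e y π h r ε f) (hr : 0 ≤ r) (hε : 0 ≤ ε) {z : Y}
    (hz : dist z y ≤ r) : ∃ a, dist a e ≤ r ∧ dist z (f a) ≤ ε := by
  obtain ⟨a, ha, hza⟩ := hf.exists_edist_le z ((edist_le_ofReal hr).2 hz)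
  exact ⟨a, (edist_le_ofReal hr).1 ha, (edist_le_ofReal hε).1 hza⟩

theorem dist_proj_le (hf : IsApproximation e y π h r ε f) (hr : 0 ≤ r) (hε : 0 ≤ ε) {a : E}
    (ha : dist a e ≤ r) : dist (h (f a)) (π a) ≤ ε :=
  (edist_le_ofReal hε).1 (hf.edist_proj_le a ((edist_le_ofReal hr).2 ha))

end IsApproximation

/-- Closed balls of a complete space that is approximated by a proper space are compact. -/
theorem isCompact_closedBall_of_isApproximation [ProperSpace E] [CompleteSpace Y]
    (H : ∀ r > 0, ∀ ε > 0, ∃ f : E → Y, IsApproximation e y π h r ε f) {r : ℝ} (hr : 0 < r) :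
    IsCompact (Metric.closedBall y r) := by
  rw [isCompact_iff_totallyBounded_isComplete]
  refine ⟨?_, Metric.isClosed_closedBall.isComplete⟩
  rw [Metric.totallyBounded_iff]
  intro ε hε
  obtain ⟨f, hf⟩ := H r hr (ε / 4) (by positivity)
  obtain ⟨t, hts, htf, ht⟩ := (isCompact_closedBall e r).finite_cover_balls
    (show 0 < ε / 4 by positivity)
  refine ⟨f '' t, htf.image f, fun z hz => ?_⟩
  obtain ⟨a, ha, hza⟩ := hf.exists_dist_le hr.le (by positivity) hz
  obtain ⟨b, hb, hab⟩ := mem_iUnion₂.1 (ht (Metric.mem_closedBall.2 ha))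
  refine mem_iUnion₂.2 ⟨f b, ⟨b, hb, rfl⟩, ?_⟩
  have h1 := hf.dist_map_le hr.le (by positivity) ha (Metric.mem_closedBall.1 (hts hb))
  have h2 := dist_triangle z (f a) (f b)
  rw [Metric.mem_ball] at hab ⊢
  linarith

/-- Uniqueness of pointed Gromov-Hausdorff limits: a complete space that is arbitrarily well
approximated by a proper space over `X` is isometric to it over `X`. -/
theorem exists_isometryEquiv_of_isApproximation [ProperSpace E] [CompleteSpace Y]
    (hh : Continuous h) (H : ∀ r > 0, ∀ ε > 0, ∃ f : E → Y, IsApproximation e y π h r ε f) :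
    ∃ Φ : E ≃ᵢ Y, ∀ a, h (Φ a) = π a := by
  have hpos : ∀ n : ℕ, (0 : ℝ) < n + 1 := fun n => by positivity
  have hpos' : ∀ n : ℕ, (0 : ℝ) < 1 / ((n : ℝ) + 1) := fun n => by positivity
  choose f hf using fun n : ℕ => H (n + 1) (hpos n) (1 / ((n : ℝ) + 1)) (hpos' n)
  -- Closed balls of `Y` are compact, so limits along a nonprincipal ultrafilter exist at all points
  -- at once, and no diagonal subsequence is needed.
  set U : Ultrafilter ℕ := hyperfilter ℕ with hU
  have hUle : (U : Filter ℕ) ≤ atTop := Nat.hyperfilter_le_atTop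
  have hlarge : ∀ s : ℝ, ∀ᶠ n : ℕ in U, s ≤ n + 1 := fun s =>
    hUle (((tendsto_natCast_atTop_atTop (R := ℝ)).eventually_ge_atTop s).mono
      fun n hn => by linarith)
  have hsmall : Tendsto (fun n : ℕ => 1 / ((n : ℝ) + 1)) U (𝓝 0) :=
    tendsto_one_div_add_atTop_nhds_zero_nat.mono_left hUle
  have hle1 : ∀ n : ℕ, 1 / ((n : ℝ) + 1) ≤ 1 := fun n => by
    rw [div_le_one (hpos n)]
    linarith [(Nat.cast_nonneg n : (0 : ℝ) ≤ n)]
  have hself : ∀ n : ℕ, dist e e ≤ (n : ℝ) + 1 := fun n => by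
    rw [dist_self]; exact (hpos n).le
  have hlim : ∀ a, ∃ z, Tendsto (fun n => f n a) U (𝓝 z) := by
    intro a
    have hmem : ∀ᶠ n in U, f n a ∈ Metric.closedBall y (dist a e + 1) := by
      filter_upwards [hlarge (dist a e)] with n hn
      have := (hf n).dist_map_le (hpos n).le (hpos' n).le hn (hself n)
      rw [(hf n).map_base] at this
      exact this.trans (add_le_add_right (hle1 n) _)
    obtain ⟨z, -, hz⟩ := (isCompact_closedBall_of_isApproximation H
      (show 0 < dist a e + 1 by positivity)).ultrafilter_le_nhds' (U.map fun n => f n a) hmem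
    exact ⟨z, hz⟩
  choose Φ hΦ using hlim
  have hiso : Isometry Φ := by
    refine Isometry.of_dist_eq fun a b => ?_
    have h1 : Tendsto (fun n => dist (f n a) (f n b)) U (𝓝 (dist (Φ a) (Φ b))) :=
      (hΦ a).dist (hΦ b)
    have h2 : Tendsto (fun n => dist (f n a) (f n b)) U (𝓝 (dist a b)) := by
      refine tendsto_of_tendsto_of_tendsto_of_le_of_le'
        (g := fun n : ℕ => dist a b - 1 / ((n : ℝ) + 1))
        (h := fun n : ℕ => dist a b + 1 / ((n : ℝ) + 1)) ?_ ?_ ?_ ?_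
      · simpa using tendsto_const_nhds.sub hsmall
      · simpa using tendsto_const_nhds.add hsmall
      · filter_upwards [hlarge (dist a e), hlarge (dist b e)] with n ha hb
        linarith [(hf n).dist_le_map (hpos n).le (hpos' n).le ha hb]
      · filter_upwards [hlarge (dist a e), hlarge (dist b e)] with n ha hb
        exact (hf n).dist_map_le (hpos n).le (hpos' n).le ha hb
    exact tendsto_nhds_unique h1 h2
  have hsurj : Function.Surjective Φ := by
    intro z
    have hex : ∀ n : ℕ, ∃ a, dist z y ≤ n + 1 →
        dist a e ≤ n + 1 ∧ dist z (f n a) ≤ 1 / ((n : ℝ) + 1) := by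
      intro n
      by_cases hz : dist z y ≤ n + 1
      · obtain ⟨a, ha⟩ := (hf n).exists_dist_le (hpos n).le (hpos' n).le hz
        exact ⟨a, fun _ => ha⟩
      · exact ⟨e, fun h => absurd h hz⟩
    choose a ha using hex
    -- The approximate preimages of `z` stay bounded: each of the two error terms is at most `1`.
    -- Properness of `E` then yields a limit `b`.
    have hmem : ∀ᶠ n in U, a n ∈ Metric.closedBall e (dist z y + 2) := by
      filter_upwards [hlarge (dist z y)] with n hn
      obtain ⟨h1, h2⟩ := ha n hn
      have h3 := (hf n).dist_le_map (hpos n).le (hpos' n).le h1 (hself n)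
      rw [(hf n).map_base] at h3
      have h4 := dist_triangle_left (f n (a n)) y z
      rw [Metric.mem_closedBall]
      linarith [hle1 n]
    obtain ⟨b, -, hb⟩ := (isCompact_closedBall e (dist z y + 2)).ultrafilter_le_nhds' (U.map a)
      hmem
    have hb' : Tendsto a U (𝓝 b) := hb
    refine ⟨b, ?_⟩
    have h1 : Tendsto (fun n => dist z (f n b)) U (𝓝 (dist z (Φ b))) :=
      tendsto_const_nhds.dist (hΦ b)
    have h2 : Tendsto (fun n : ℕ => 1 / ((n : ℝ) + 1) + (dist (a n) b + 1 / ((n : ℝ) + 1))) U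
        (𝓝 0) := by
      have := hsmall.add ((tendsto_iff_dist_tendsto_zero.1 hb').add hsmall)
      simpa using this
    have h3 : dist z (Φ b) ≤ 0 := by
      refine le_of_tendsto_of_tendsto h1 h2 ?_
      filter_upwards [hlarge (dist z y), hlarge (dist b e)] with n hn hbn
      obtain ⟨h4, h5⟩ := ha n hn
      have h6 := (hf n).dist_map_le (hpos n).le (hpos' n).le h4 hbn
      exact (dist_triangle z (f n (a n)) (f n b)).trans (add_le_add h5 h6)
    exact (dist_le_zero.1 h3).symm
  refine ⟨IsometryEquiv.mk' Φ (Function.surjInv hsurj) (Function.surjInv_eq hsurj) hiso,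
    fun a => ?_⟩
  change h (Φ a) = π a
  have h1 : Tendsto (fun n => h (f n a)) U (𝓝 (h (Φ a))) := (hh.tendsto _).comp (hΦ a)
  have h2 : Tendsto (fun n => h (f n a)) U (𝓝 (π a)) := by
    rw [tendsto_iff_dist_tendsto_zero]
    refine squeeze_zero' (Eventually.of_forall fun _ => dist_nonneg) ?_ hsmall
    filter_upwards [hlarge (dist a e)] with n hn
    exact (hf n).dist_proj_le (hpos n).le (hpos' n).le hn
  exact tendsto_nhds_unique h1 h2

end GromovHausdorff

/-! ### Change of base point and uniqueness of the cut-off cover. -/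

namespace PathCover

section BaseChange

variable {X : Type u} {p p' : X}

/-- The map between covers that changes the base point along a path. -/
noncomputable def baseChange [TopologicalSpace X] {H : Subgroup (FundamentalGroup X p)}
    {H' : Subgroup (FundamentalGroup X p')} (α : Path p' p)
    (h : ∀ c : Path p p, loopClass c ∈ H → loopClass ((α.trans c).trans α.symm) ∈ H') :
    PathCover H → PathCover H' :=
  Quotient.map' (fun a => ⟨a.1, α.trans a.2⟩) fun a b hab => by
    obtain ⟨y, γ⟩ := a
    obtain ⟨z, σ⟩ := b
    obtain ⟨hyz, hm⟩ := hab
    obtain rfl : y = z := hyz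
    refine ⟨rfl, ?_⟩
    have h1 := h _ hm
    rwa [loopClass_congr] at h1
    simp [Path.trans_symm, Path.Homotopic.Quotient.trans_assoc]

theorem baseChange_mk [TopologicalSpace X] {H : Subgroup (FundamentalGroup X p)}
    {H' : Subgroup (FundamentalGroup X p')} (α : Path p' p)
    (h : ∀ c : Path p p, loopClass c ∈ H → loopClass ((α.trans c).trans α.symm) ∈ H') {y : X}
    (γ : Path p y) : baseChange α h (mk H γ) = mk H' (α.trans γ) := rfl

theorem edist_baseChange_le [PseudoEMetricSpace X] {H : Subgroup (FundamentalGroup X p)}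
    {H' : Subgroup (FundamentalGroup X p')} (α : Path p' p)
    (h : ∀ c : Path p p, loopClass c ∈ H → loopClass ((α.trans c).trans α.symm) ∈ H')
    (a b : PathCover H) : edist (baseChange α h a) (baseChange α h b) ≤ edist a b := by
  refine le_coverEDist H ?_
  rintro y z γ c rfl rfl
  rw [baseChange_mk, baseChange_mk, mk_eq_of_homotopic H' (γ := α.trans (γ.trans c))
    (σ := (α.trans γ).trans c) (by simp [Path.Homotopic.Quotient.trans_assoc])]
  exact edist_mk_trans_le H' _ c

theorem baseChange_baseChange [TopologicalSpace X] {H : Subgroup (FundamentalGroup X p)}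
    {H' : Subgroup (FundamentalGroup X p')} (α : Path p' p) (β : Path p p')
    (hβα : Path.Homotopic.Quotient.mk (β.trans α) = Path.Homotopic.Quotient.mk (Path.refl p))
    (h : ∀ c : Path p p, loopClass c ∈ H → loopClass ((α.trans c).trans α.symm) ∈ H')
    (h' : ∀ c : Path p' p', loopClass c ∈ H' → loopClass ((β.trans c).trans β.symm) ∈ H)
    (a : PathCover H) : baseChange β h' (baseChange α h a) = a := by
  obtain ⟨y, γ, rfl⟩ := exists_mk_eq H a
  rw [baseChange_mk, baseChange_mk]
  refine mk_eq_of_homotopic H ?_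
  rw [Path.Homotopic.Quotient.mk_trans, Path.Homotopic.Quotient.mk_trans,
    ← Path.Homotopic.Quotient.trans_assoc, ← Path.Homotopic.Quotient.mk_trans, hβα]
  simp

/-- Covers with conjugate covering groups are isometric over `X`. -/
theorem exists_isometryEquiv_of_conj [PseudoEMetricSpace X]
    {H : Subgroup (FundamentalGroup X p)}
    {H' : Subgroup (FundamentalGroup X p')} (α : Path p' p)
    (h : ∀ c : Path p p, loopClass c ∈ H → loopClass ((α.trans c).trans α.symm) ∈ H')
    (h' : ∀ c : Path p' p', loopClass c ∈ H' →
      loopClass ((α.symm.trans c).trans α.symm.symm) ∈ H) :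
    ∃ Φ : PathCover H ≃ᵢ PathCover H', ∀ a, proj H' (Φ a) = proj H a := by
  have h1 := baseChange_baseChange α α.symm (by simp) h h'
  have h2 := baseChange_baseChange α.symm α (by simp) h' h
  refine ⟨⟨⟨baseChange α h, baseChange α.symm h', h1, h2⟩, fun a b => ?_⟩, fun a => ?_⟩
  · refine le_antisymm (edist_baseChange_le α h a b) ?_
    have := edist_baseChange_le α.symm h' (baseChange α h a) (baseChange α h b)
    rwa [h1, h1] at this
  · obtain ⟨y, γ, rfl⟩ := exists_mk_eq H a
    rfl

end BaseChange

variable {X : Type u} [MetricSpace X] {δ : ℝ}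

theorem exists_isometryEquiv_limitGroup (hX : IsLengthSpace X) (δ : ℝ) (x x' : X) :
    ∃ Φ : PathCover (limitGroup δ x x) ≃ᵢ PathCover (limitGroup δ x' x'),
      ∀ a, proj _ (Φ a) = proj _ a := by
  obtain ⟨α, -⟩ := hX.exists_curveLength_lt (edist_lt_top x' x)
  rw [limitGroup_center δ x x' x]
  exact exists_isometryEquiv_of_conj α (fun c hc => loopClass_conj_mem_limitGroup α hc)
    (fun c hc => loopClass_conj_mem_limitGroup α.symm hc)

/-- An approximation from the `R` cut-off cover to `Y`, composed with `mapOfLE` for `R` large, is an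
approximation from the proper limit cover to `Y`. -/
theorem exists_isometryEquiv_of_isCutoffLimit [ProperSpace X] (hX : IsLengthSpace X)
    (hδ : 0 < δ) {x : X} {Y : Type u} [MetricSpace Y] {y : Y} {h : Y → X}
    (hY : IsCutoffLimit δ x y h) :
    ∃ Φ : PathCover (limitGroup δ x x) ≃ᵢ Y, ∀ a, h (Φ a) = proj _ a := by
  obtain ⟨hc, hh, hGH⟩ := hY
  let _ := metricSpace hX hδ (deltaGroup_le_limitGroup δ x x)
  have := properSpace hX hδ (deltaGroup_le_limitGroup δ x x)
  refine exists_isometryEquiv_of_isApproximation (e := base (limitGroup δ x x)) (y := y) hh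
    fun r hr ε hε => ?_
  obtain ⟨R, ⟨f, h1, -, h3, h4, h5⟩, hiso, hsurj⟩ := ((hGH r hr ε hε).and
    ((eventually_edist_mapOfLE_eq (p := x) hX hδ x hr.le).and
    (eventually_exists_mapOfLE_eq (p := x) hX hδ x hr.le))).exists
  have hball : ∀ a : PathCover (limitGroup δ x x), edist a (base _) ≤ ENNReal.ofReal r →
      edist (mapOfLE (limitGroup_le δ R x x) a) (base (cutoffGroup δ R x)) ≤
        ENNReal.ofReal r := fun a ha =>
    (edist_mapOfLE_le (limitGroup_le δ R x x) a (base _)).trans ha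
  refine ⟨fun a => f (mapOfLE (limitGroup_le δ R x x) a), h1, fun a b ha hb => ?_,
    fun z hz => ?_, fun a ha => ?_⟩
  · rw [← hiso a b ha hb]
    exact h3 _ _ (hball a ha) (hball b hb)
  · obtain ⟨a', ha', hza⟩ := h4 z hz
    obtain ⟨a, ha, rfl⟩ := hsurj a' ha'
    exact ⟨a, ha, hza⟩
  · rw [← proj_mapOfLE (limitGroup_le δ R x x) a]
    exact h5 _ (hball a ha)

theorem exists_isometryEquiv_of_isCutoffCover [ProperSpace X] (hX : IsLengthSpace X)
    (hδ : 0 < δ) (x : X) {Y : Type u} [MetricSpace Y] {h : Y → X} (hY : IsCutoffCover δ h) :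
    ∃ Φ : PathCover (limitGroup δ x x) ≃ᵢ Y, ∀ a, h (Φ a) = proj _ a := by
  obtain ⟨x', y, hy⟩ := hY
  obtain ⟨Φ, hΦ⟩ := exists_isometryEquiv_limitGroup hX δ x x'
  obtain ⟨Ψ, hΨ⟩ := exists_isometryEquiv_of_isCutoffLimit hX hδ hy
  exact ⟨Φ.trans Ψ, fun a => (hΨ _).trans (hΦ a)⟩

end PathCover

/-! ### Equality of covers as equality of groups. -/

namespace PathCover

variable {X : Type u} [MetricSpace X] {p : X}

/-- Lifts of paths are unique. -/
theorem eq_one_of_proj_eq {δ : ℝ} (hδ : 0 < δ) {K : Subgroup (FundamentalGroup X p)}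
    (hK : deltaGroup δ p ≤ K) {f g : unitInterval → PathCover K} (hf : Continuous f)
    (hg : Continuous g) (hfg : ∀ t, proj K (f t) = proj K (g t)) (h0 : f 0 = g 0) :
    f 1 = g 1 := by
  have hcont : Continuous fun t => edist (f t) (g t) := hf.edist hg
  have hclopen : IsClopen {t | f t = g t} := by
    constructor
    · have : {t | f t = g t} = {t | edist (f t) (g t) ≤ 0} := by
        ext t
        refine ⟨fun h => ?_, fun h => eq_of_edist_eq_zero hδ hK (le_antisymm h zero_le)⟩
        rw [mem_ofPred_eq, show f t = g t from h, edist_self]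
      rw [this]
      exact isClosed_le hcont continuous_const
    · have : {t | f t = g t} = {t | edist (f t) (g t) < ENNReal.ofReal δ} := by
        ext t
        refine ⟨fun h => ?_, fun h => eq_of_proj_eq_of_edist_lt hK (hfg t) h⟩
        rw [mem_ofPred_eq, show f t = g t from h, edist_self]
        exact ENNReal.ofReal_pos.2 hδ
      rw [this]
      exact isOpen_lt hcont continuous_const
  have h1 : (1 : unitInterval) ∈ {t | f t = g t} := by
    rw [hclopen.eq_univ ⟨0, h0⟩]
    trivial
  exact h1

/-- A loop `c` in `H` lifts to a closed curve at the base point. Its image under `Φ` is the lift of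
`c` at `[σ]`, again closed, so `σ c σ⁻¹` lies in `K`. As `Φ` may move the base point, normality is
needed to remove `σ`. -/
theorem le_of_sameCover (hX : IsLengthSpace X) {δ δ' : ℝ} (hδ : 0 < δ) (hδ' : 0 < δ')
    {H K : Subgroup (FundamentalGroup X p)} (hH : deltaGroup δ p ≤ H) (hK : deltaGroup δ' p ≤ K)
    (hconj : ∀ α c : Path p p, loopClass c ∈ K → loopClass ((α.trans c).trans α.symm) ∈ K)
    (h : SameCover (proj H) (proj K)) : H ≤ K := by
  obtain ⟨Φ, hΦ⟩ := h
  intro g hg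
  obtain ⟨c, rfl⟩ : ∃ c : Path p p, loopClass c = g := Path.Homotopic.Quotient.mk_surjective g
  obtain ⟨y, σ, hσ⟩ := exists_mk_eq K (Φ (base H))
  obtain rfl : p = y := by
    have := hΦ (base H)
    rw [← hσ] at this
    exact this.symm
  have key : Φ (lift H (Path.refl p) c 1) = lift K σ c 1 := by
    refine eq_one_of_proj_eq hδ' hK
      (Φ.continuous.comp (continuous_lift hX hδ hH (Path.refl p) c))
      (continuous_lift hX hδ' hK σ c) (fun t => hΦ _) ?_
    rw [Function.comp_apply, lift_zero, lift_zero, hσ]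
    rfl
  rw [lift_one, lift_one, mk_eq_of_homotopic H (γ := (Path.refl p).trans c) (σ := c) (by simp),
    (mk_eq_base_iff H c).2 hg, ← hσ, eq_comm, mk_eq_mk_iff] at key
  have h1 := hconj σ.symm _ key
  rwa [loopClass_congr (d := c)] at h1
  simp [Path.Homotopic.Quotient.trans_assoc, quotient_trans_symm_cancel]

theorem sameCover_iff_eq (hX : IsLengthSpace X) {δ δ' : ℝ} (hδ : 0 < δ) (hδ' : 0 < δ')
    {H K : Subgroup (FundamentalGroup X p)} (hH : deltaGroup δ p ≤ H) (hK : deltaGroup δ' p ≤ K)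
    (hHconj : ∀ α c : Path p p, loopClass c ∈ H → loopClass ((α.trans c).trans α.symm) ∈ H)
    (hKconj : ∀ α c : Path p p, loopClass c ∈ K → loopClass ((α.trans c).trans α.symm) ∈ K) :
    SameCover (proj H) (proj K) ↔ H = K := by
  constructor
  · rintro ⟨Φ, hΦ⟩
    refine le_antisymm (le_of_sameCover hX hδ hδ' hH hK hKconj ⟨Φ, hΦ⟩)
      (le_of_sameCover hX hδ' hδ hK hH hHconj ⟨Φ.symm, fun a => ?_⟩)
    rw [← hΦ, Φ.apply_symm_apply]
  · rintro rfl
    exact ⟨Homeomorph.refl _, fun _ => rfl⟩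

end PathCover

/-! ### The spectra as jumps of families of groups. -/

section Spectra

variable {X : Type u} [MetricSpace X]

theorem mem_covSpec_iff (hX : IsLengthSpace X) {δ : ℝ} :
    δ ∈ covSpec X ↔ 0 < δ ∧ ∀ δ' > δ, ∀ p : X, deltaGroup δ p ≠ deltaGroup δ' p := by
  refine and_congr_right fun hδ => forall₂_congr fun δ' hδ' => forall_congr' fun p => not_congr ?_
  exact PathCover.sameCover_iff_eq hX hδ (hδ.trans hδ') le_rfl le_rfl
    (fun α _ hc => loopClass_conj_mem_spanierGroup α hc)
    (fun α _ hc => loopClass_conj_mem_spanierGroup α hc)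

theorem mem_rCutoffCovSpec_iff (hX : IsLengthSpace X) {δ R : ℝ} {x : X} :
    δ ∈ rCutoffCovSpec R x ↔ 0 < δ ∧ ∀ δ' > δ, cutoffGroup δ R x ≠ cutoffGroup δ' R x := by
  refine and_congr_right fun hδ => forall₂_congr fun δ' hδ' => not_congr ?_
  exact PathCover.sameCover_iff_eq hX hδ (hδ.trans hδ')
    (deltaGroup_le_spanierGroup_cutoffSets δ R x x)
    (deltaGroup_le_spanierGroup_cutoffSets δ' R x x)
    (fun α _ hc => loopClass_conj_mem_spanierGroup α hc)
    (fun α _ hc => loopClass_conj_mem_spanierGroup α hc)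

theorem mem_cutoffCovSpec_iff [ProperSpace X] (hX : IsLengthSpace X) {δ : ℝ} (x : X) :
    δ ∈ cutoffCovSpec X ↔ 0 < δ ∧ ∀ δ' > δ, limitGroup δ x x ≠ limitGroup δ' x x := by
  refine and_congr_right fun hδ => forall₂_congr fun δ' hδ' => ?_
  have hδ'0 : 0 < δ' := hδ.trans hδ'
  have hiff := PathCover.sameCover_iff_eq hX hδ hδ'0 (deltaGroup_le_limitGroup δ x x)
    (deltaGroup_le_limitGroup δ' x x) (fun α _ hc => loopClass_conj_mem_limitGroup α hc)
    (fun α _ hc => loopClass_conj_mem_limitGroup α hc)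
  constructor
  · intro h heq
    exact @h _ _ (PathCover.metricSpace hX hδ (deltaGroup_le_limitGroup δ x x))
      (PathCover.metricSpace hX hδ'0 (deltaGroup_le_limitGroup δ' x x)) _ _
      ⟨x, _, PathCover.isCutoffLimit hX hδ x⟩ ⟨x, _, PathCover.isCutoffLimit hX hδ'0 x⟩
      (hiff.2 heq)
  · intro hne Y Z _ _ h k hh hk ⟨Θ, hΘ⟩
    obtain ⟨Φ, hΦ⟩ := PathCover.exists_isometryEquiv_of_isCutoffCover hX hδ x hh
    obtain ⟨Ψ, hΨ⟩ := PathCover.exists_isometryEquiv_of_isCutoffCover hX hδ'0 x hk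
    refine hne (hiff.1 ⟨(Φ.toHomeomorph.trans Θ).trans Ψ.toHomeomorph.symm, fun a => ?_⟩)
    rw [← hΨ, ← hΦ, ← hΘ]
    exact congrArg k (Ψ.apply_symm_apply _)

theorem cutoffCovSpec_subset_covSpec [ProperSpace X] (hX : IsLengthSpace X) :
    cutoffCovSpec X ⊆ covSpec X := by
  intro δ hδ
  refine (mem_covSpec_iff hX).2 ⟨hδ.1, fun δ' hδ' p heq => ?_⟩
  refine ((mem_cutoffCovSpec_iff hX p).1 hδ).2 δ' hδ' ?_
  exact iInf_congr fun R => by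
    rw [spanierGroup_cutoffSets, spanierGroup_cutoffSets, heq]

theorem rCutoffCovSpec_subset_cutoffCovSpec [ProperSpace X] (hX : IsLengthSpace X) (R : ℝ)
    (x : X) : rCutoffCovSpec R x ⊆ cutoffCovSpec X := by
  intro δ hδ
  refine (mem_cutoffCovSpec_iff hX x).2 ⟨hδ.1, fun δ' hδ' heq => ?_⟩
  refine ((mem_rCutoffCovSpec_iff hX).1 hδ).2 δ' hδ' ?_
  refine spanierGroup_cutoffSets_eq_of_le hδ'.le ?_
  -- Equality of the limit groups places the `δ'`-group inside the `R` cut-off group for `δ`.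
  exact (deltaGroup_le_limitGroup δ' x x).trans (heq ▸ limitGroup_le δ R x x)

/-- If the limit groups did not jump at `l > 0`, they would be constant on some `[l, δ']`, which
contains a term `a n < δ'` of the sequence, where they do jump. The point `0` is adjoined because a
sequence in the spectrum may decrease to it. -/
theorem isLowerSemiclosed_cutoffCovSpec [ProperSpace X] (hX : IsLengthSpace X) (x : X) :
    IsLowerSemiclosed (cutoffCovSpec X ∪ {0}) := by
  intro a l ha hmem hl
  have hle : ∀ n, l ≤ a n := fun n => ha.le_of_tendsto hl n
  have hnonneg : 0 ≤ l := ge_of_tendsto' hl fun n => by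
    rcases hmem n with h | h
    · exact h.1.le
    · exact (show a n = 0 from h).ge
  rcases hnonneg.eq_or_lt with h0 | h0
  · exact Or.inr h0.symm
  refine Or.inl ((mem_cutoffCovSpec_iff hX x).2 ⟨h0, fun δ' hδ' heq => ?_⟩)
  obtain ⟨n, hn⟩ := (hl.eventually_lt_const hδ').exists
  have hspec : a n ∈ cutoffCovSpec X :=
    (hmem n).resolve_right (h0.trans_le (hle n)).ne'
  refine ((mem_cutoffCovSpec_iff hX x).1 hspec).2 δ' hn ?_
  exact le_antisymm (limitGroup_mono hn.le x x) (heq ▸ limitGroup_mono (hle n) x x)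

/-- If the `R` cut-off covers for `δ` and `δ'` differ, there is an element of the `R` cut-off
covering spectrum in `[δ, δ')`. -/
theorem exists_mem_rCutoffCovSpec (hX : IsLengthSpace X) {δ δ' R : ℝ} {x : X} (hδ : 0 < δ)
    (hδ' : δ < δ') (hne : cutoffGroup δ R x ≠ cutoffGroup δ' R x) :
    ∃ s ∈ rCutoffCovSpec R x, δ ≤ s ∧ s < δ' := by
  set S := {t | δ ≤ t ∧ cutoffGroup t R x = cutoffGroup δ R x} with hS
  have hmono : ∀ {t t' : ℝ}, t ≤ t' → cutoffGroup t R x ≤ cutoffGroup t' R x := fun h =>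
    spanierGroup_cutoffSets_mono h R x x
  have hlt : ∀ t ∈ S, t < δ' := by
    rintro t ⟨-, ht⟩
    by_contra! hle
    exact hne (le_antisymm (hmono hδ'.le) ((hmono hle).trans ht.le))
  have hδS : δ ∈ S := ⟨le_rfl, rfl⟩
  have hbdd : BddAbove S := ⟨δ', fun t ht => (hlt t ht).le⟩
  have hδs : δ ≤ sSup S := le_csSup hbdd hδS
  have hsS : sSup S ∈ S := by
    refine ⟨hδs, ?_⟩
    -- Continuity from the left is only of use when there is room between `δ` and the supremum;
    -- otherwise the supremum is `δ` itself.
    rcases hδs.eq_or_lt with h | h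
    · rw [← h]
    refine le_antisymm (spanierGroup_cutoffSets_le_of_forall_lt h fun t _ hts => ?_) (hmono hδs)
    obtain ⟨t', ht', htt'⟩ := exists_lt_of_lt_csSup ⟨δ, hδS⟩ hts
    exact (hmono htt'.le).trans ht'.2.le
  refine ⟨sSup S, (mem_rCutoffCovSpec_iff hX).2 ⟨hδ.trans_le hδs, fun t ht heq => ?_⟩, hδs,
    hlt _ hsS⟩
  exact ht.not_ge (le_csSup hbdd ⟨hδs.trans ht.le, heq.symm.trans hsS.2⟩)

end Spectra

/-- If `l` were not in `B`, it would be the infimum of the elements of `B` above it, hence the limit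
of a decreasing sequence of them. -/
theorem mem_of_isLowerSemiclosed {B : Set ℝ} (hB : IsLowerSemiclosed B) {l : ℝ}
    (h : ∀ u > l, ∃ s ∈ B, l ≤ s ∧ s < u) : l ∈ B := by
  by_contra hl
  have h' : ∀ u > l, ∃ s, (s ∈ B ∧ l < s) ∧ s < u := fun u hu => by
    obtain ⟨s, hs, hls, hsu⟩ := h u hu
    exact ⟨s, ⟨hs, hls.lt_of_ne fun e => hl (e ▸ hs)⟩, hsu⟩
  have hglb : IsGLB {s | s ∈ B ∧ l < s} l := by
    refine ⟨fun s hs => hs.2.le, fun b hb => le_of_forall_gt fun u hu => ?_⟩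
    obtain ⟨s, hs, hsu⟩ := h' u hu
    exact (hb hs).trans_lt hsu
  obtain ⟨s, hs, -⟩ := h' (l + 1) (lt_add_one l)
  obtain ⟨a, ha, -, hlim, hmem⟩ := hglb.exists_seq_antitone_tendsto ⟨s, hs⟩
  exact hl (hB a l ha (fun n => (hmem n).1) hlim)

theorem cutoffCovSpec_subset_lowerSemiclosure {X : Type u} [MetricSpace X] [ProperSpace X]
    (hX : IsLengthSpace X) (x : X) :
    cutoffCovSpec X ⊆ lowerSemiclosure (⋃ R ∈ Ioi (0 : ℝ), rCutoffCovSpec R x) := by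
  rintro δ hδ B ⟨hB, hsub⟩
  refine mem_of_isLowerSemiclosed hB fun δ' hδ' => ?_
  obtain ⟨R, hR, hne⟩ : ∃ R ∈ Ioi (0 : ℝ), cutoffGroup δ R x ≠ cutoffGroup δ' R x := by
    by_contra! hall
    refine ((mem_cutoffCovSpec_iff hX x).1 hδ).2 δ' hδ' (le_antisymm
      (limitGroup_mono (le_of_lt hδ') x x) (le_iInf fun R => ?_))
    -- The limit group is an intersection over all real `R`, the union of spectra is over `R > 0`;
    -- passing to `max R 1` reconciles the two.
    refine (limitGroup_le δ' (max R 1) x x).trans ?_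
    refine (hall (max R 1) (mem_Ioi.2 (lt_max_of_lt_right one_pos))).ge.trans ?_
    exact spanierGroup_cutoffSets_le_of_closedBall_subset
      (Metric.closedBall_subset_closedBall (le_max_left R 1)) x
  obtain ⟨s, hs, hδs, hsδ'⟩ := exists_mem_rCutoffCovSpec hX hδ.1 hδ' hne
  exact ⟨s, hsub (mem_biUnion hR hs), hδs, hsδ'⟩

end CutoffSpectrum

theorem theorem4p11 {X : Type u} [MetricSpace X] [CompleteSpace X] [LocallyCompactSpace X]
    [Nonempty X] (hX : CutoffSpectrum.IsLengthSpace X) :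
    -- the cut-off `δ`-cover exists, from every base point, and it is unique
    (∀ δ : ℝ, 0 < δ →
      (∀ x : X, ∃ (Y : Type u) (_ : MetricSpace Y) (y : Y) (h : Y → X),
        CutoffSpectrum.IsCutoffLimit δ x y h) ∧
      (∀ (Y Z : Type u) [MetricSpace Y] [MetricSpace Z] (h : Y → X) (k : Z → X),
        CutoffSpectrum.IsCutoffCover δ h → CutoffSpectrum.IsCutoffCover δ k →
        ∃ Φ : Y ≃ᵢ Z, ∀ a, k (Φ a) = h a)) ∧
    -- the inclusion of the spectra
    CutoffSpectrum.cutoffCovSpec X ⊆ CutoffSpectrum.covSpec X ∧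
    -- the cut-off covering spectrum in terms of the `R` cut-off covering spectra
    (∀ x : X,
      CutoffSpectrum.lowerSemiclosure (⋃ R ∈ Set.Ioi (0 : ℝ), CutoffSpectrum.rCutoffCovSpec R x)
          ∪ {0} =
        CutoffSpectrum.cutoffCovSpec X ∪ {0}) := by
  have := hX.properSpace
  refine ⟨fun δ hδ => ⟨fun x => ⟨_, _, _, _, CutoffSpectrum.PathCover.isCutoffLimit hX hδ x⟩,
    fun Y Z _ _ h k hh hk => ?_⟩, CutoffSpectrum.cutoffCovSpec_subset_covSpec hX, fun x => ?_⟩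
  · obtain ⟨x⟩ := ‹Nonempty X›
    obtain ⟨Φ, hΦ⟩ :=
      CutoffSpectrum.PathCover.exists_isometryEquiv_of_isCutoffCover hX hδ x hh
    obtain ⟨Ψ, hΨ⟩ :=
      CutoffSpectrum.PathCover.exists_isometryEquiv_of_isCutoffCover hX hδ x hk
    refine ⟨Φ.symm.trans Ψ, fun a => ?_⟩
    rw [IsometryEquiv.trans_apply, hΨ, ← hΦ, Φ.apply_symm_apply]
  · refine Subset.antisymm (union_subset ?_ subset_union_right) (union_subset_union_left _
      (CutoffSpectrum.cutoffCovSpec_subset_lowerSemiclosure hX x))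
    -- The lower semiclosure is the least lower semiclosed set containing the union, so it suffices
    -- that `cutoffCovSpec X ∪ {0}` is such a set.
    refine sInter_subset_of_mem
      ⟨CutoffSpectrum.isLowerSemiclosed_cutoffCovSpec hX x, iUnion₂_subset fun R _ => ?_⟩
    exact (CutoffSpectrum.rCutoffCovSpec_subset_cutoffCovSpec hX R x).trans subset_union_left
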